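/- Let $d\ge 2$ and $q\ge 1$. There exists $\tilde p\in(0,1)$, depending only on $d$ and $q$, such that the following holds for every $p\in[\tilde p,1)$. Let $\Lambda$ be a closed $d$-cube in $\mathbb R^d$ centred at the origin, in an arbitrary orientation, regarded also as the subgraph $(V,E)$ of the lattice $\mathbb Z^d$ (nearest-neighbour edges) induced on the lattice points in the cube; $|\Lambda|$ is the number of its vertices. Let $\partial\Lambda$ be the set of vertices of $\Lambda$ having a lattice neighbour outside the cube. Fix a hyperplane through the origin parallel to a side of the cube, and let $T,B\subset\partial\Lambda$ be disjoint, $T$ containing all vertices of $\partial\Lambda$ strictly on one side of the hyperplane and $B$ all those strictly on the other side (vertices of $\partial\Lambda$ on the hyperplane may be in $T$, in $B$ or in neither). For $\omega\in\{0,1\}^E$ ($1$ = open, $0$ = closed) and $e\in E$ let $\omega^e,\omega_e$ be $\omega$ with $e$ opened, respectively closed, and write $T\overset{\omega}{\longleftrightarrow}B$ if a path of open edges of $\Lambda$ joins $T$ to $B$. Let $\Phi=\Phi^{TB}_{\Lambda,p,q}$ be the random-cluster measure on $\{0,1\}^E$ with all vertices of $T$ wired together and all vertices of $B$ wired together, i.e.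 $\Phi(\omega)\propto q^{k(\omega)}\prod_{e\in E}p^{\omega(e)}(1-p)^{1-\omega(e)}$, where $k(\omega)$ is the number of open clusters after this wiring. Consider the coupled Gibbs sampler $(X_t,Y_t)_{t\in\mathbb N}$ driven by i.i.d. pairs $(E_t,U_t)_{t\ge1}$, independent of $(X_0,Y_0)$, uniform on $E\times[0,1]$. At time $t$ only the edge $e=E_t$ may change. If $X_{t-1}=\omega$, then $X_t=\omega^e$ if $U_t\ge\frac{\Phi(\omega_e)}{\Phi(\omega^e)+\Phi(\omega_e)}$ and $X_t=\omega_e$ otherwise. If $Y_{t-1}=\omega$, then $Y_t=\omega^e$ if both $U_t\ge\frac{\Phi(\omega_e)}{\Phi(\omega^e)+\Phi(\omega_e)}$ and $T\overset{\omega^e}{\longleftrightarrow}B$ fails, and $Y_t=\omega_e$ otherwise. Let $P_\mu$ be the law of this process when $(X_0,Y_0)$ has the equilibrium distribution $\mu$ of the chain on the set of pairs $(\omega_1,\omega_2)$ with $\omega_1\ge\omega_2$ and $T,B$ not connected in $\omega_2$. A cut is an inclusion-minimal set of edges of $\Lambda$ whose removal leaves no path in $\Lambda$ from $T$ to $B$.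 Let $\mathcal C_t$ be the set of cuts all of whose edges are closed in $Y_t$, and let $\mathcal P_t=\{e\in E: T\overset{Y_t^e}{\longleftrightarrow}B\}$ be the set of pivotal edges. Distances are Euclidean, an edge being identified with its unit segment in $\mathbb R^d$, and $\Lambda^c$ is the complement of the cube (the distance to the empty set is $+\infty$). Then for every such $\Lambda$, every $t\in\mathbb N$, every $s\in\{1,\dots,|\Lambda|\}$, every real $\ell\ge 1$ and every edge $e$ of $\Lambda$ at distance more than $\ell$ from $\Lambda^c$, $$P_\mu\Big(e\in\mathcal P_{t+s}\ \Big|\ \exists\, c_t\in\mathcal C_t,\ d(e,c_t)\ge\ell\Big)\le e^{-\ell}$$ (the conditional probability being read as $0$ if the conditioning event has probability $0$). -/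

import Mathlib

open MeasureTheory ProbabilityTheory
open scoped ENNReal

noncomputable section

namespace FK

/-! ### The lattice and tilted cubes -/

/-- The point of `ℤ^d`, seen in `ℝ^d` with its Euclidean norm. -/
def latticePoint {d : ℕ} (x : Fin d → ℤ) : EuclideanSpace ℝ (Fin d) :=
  WithLp.toLp 2 (fun i => (x i : ℝ))

/-- The lattice `𝕃^d`: two points of `ℤ^d` are adjacent when their Euclidean distance is `1`. -/
def lattice (d : ℕ) : SimpleGraph (Fin d → ℤ) where
  Adj x y := dist (latticePoint x) (latticePoint y) = 1
  symm := ⟨fun x y h => by rw [dist_comm]; exact h⟩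
  loopless := ⟨fun x h => by simp at h⟩

/-- Euclidean distance between two subsets of `ℝ^d` (it is `∞` when one of them is empty). -/
def setDist {d : ℕ} (A B : Set (EuclideanSpace ℝ (Fin d))) : ℝ≥0∞ :=
  ⨅ x ∈ A, Metric.infEDist x B

/-- A `d`-cube centred at the origin, in an arbitrary orientation: its sides are orthogonal to the
vectors of an orthonormal basis. One direction of the basis is singled out: the hyperplane through
the origin orthogonal to it (hence parallel to a side) splits the cube into two halves. -/
structure Cube (d : ℕ) where
  basis : OrthonormalBasis (Fin d) ℝ (EuclideanSpace ℝ (Fin d))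
  halfSide : ℝ
  halfSide_pos : 0 < halfSide
  axis : Fin d

namespace Cube

variable {d : ℕ} (K : Cube d)

/-- The closed cube in `ℝ^d`. -/
def carrier : Set (EuclideanSpace ℝ (Fin d)) :=
  {z | ∀ i, |inner ℝ (K.basis i) z| ≤ K.halfSide}

/-- The vertices of the box: the points of `ℤ^d` in the cube. -/
abbrev Vertex : Type := {x : Fin d → ℤ // latticePoint x ∈ K.carrier}

/-- The box as a graph: the subgraph of `𝕃^d` induced on the vertices in the cube. -/
def graph : SimpleGraph K.Vertex := (lattice d).comap Subtype.val

/-- The edges of the box. -/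
abbrev Edge : Type := {e : Sym2 K.Vertex // e ∈ K.graph.edgeSet}

/-- The boundary of the box: the vertices having a lattice neighbour outside the cube. -/
def boundary : Set K.Vertex :=
  {x | ∃ y : Fin d → ℤ, latticePoint y ∉ K.carrier ∧ (lattice d).Adj x.1 y}

/-- Signed distance of a vertex to the middle hyperplane. -/
def height (x : K.Vertex) : ℝ := inner ℝ (K.basis K.axis) (latticePoint x.1)

/-- The unit segment of `ℝ^d` associated with an edge. -/
def segment (e : K.Edge) : Set (EuclideanSpace ℝ (Fin d)) :=
  convexHull ℝ ((fun x : K.Vertex => latticePoint x.1) '' {x | x ∈ e.1})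

/-- The subset of `ℝ^d` covered by a set of edges. -/
def support (S : Set K.Edge) : Set (EuclideanSpace ℝ (Fin d)) := ⋃ f ∈ S, K.segment f

/-- The distance `d(e, S)` between an edge and a set of edges. -/
def distEdges (e : K.Edge) (S : Set K.Edge) : ℝ≥0∞ := setDist (K.segment e) (K.support S)

/-- The distance `d(e, Λᶜ)` between an edge and the complement of the cube. -/
def distCompl (e : K.Edge) : ℝ≥0∞ := setDist (K.segment e) K.carrierᶜ

instance : Finite K.Vertex := by
  have hb : ∀ z ∈ K.carrier, ‖z‖ ^ 2 ≤ d * K.halfSide ^ 2 := by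
    intro z hz
    rw [← K.basis.sum_sq_norm_inner_right z]
    calc ∑ i, ‖inner ℝ (K.basis i) z‖ ^ 2 ≤ ∑ _i : Fin d, K.halfSide ^ 2 := by
          refine Finset.sum_le_sum fun i _ => ?_
          rw [Real.norm_eq_abs]
          exact pow_le_pow_left₀ (abs_nonneg _) (hz i) 2
      _ = d * K.halfSide ^ 2 := by simp
  obtain ⟨N, hN⟩ := exists_nat_ge (d * K.halfSide ^ 2 + 1)
  refine Set.Finite.subset (Set.Finite.pi' (fun _ : Fin d => Set.finite_Icc (-(N : ℤ)) N)) ?_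
  intro x hx i
  have h1 := hb _ hx
  have h2 : (x i : ℝ) ^ 2 ≤ ‖latticePoint x‖ ^ 2 := by
    rw [EuclideanSpace.norm_sq_eq]
    have := Finset.single_le_sum (f := fun j => ‖latticePoint x j‖ ^ 2)
      (fun j _ => sq_nonneg _) (Finset.mem_univ i)
    simpa [latticePoint] using this
  have h3 : |(x i : ℝ)| ≤ N := by
    by_contra hc
    push Not at hc
    have : (N : ℝ) ^ 2 < (x i : ℝ) ^ 2 := by
      rw [← sq_abs (x i : ℝ)]
      exact pow_lt_pow_left₀ hc (Nat.cast_nonneg N) two_ne_zero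
    nlinarith [mul_nonneg (Nat.cast_nonneg (α := ℝ) d) (sq_nonneg K.halfSide)]
  rw [abs_le] at h3
  exact ⟨by exact_mod_cast h3.1, by exact_mod_cast h3.2⟩

instance : Finite (Sym2 K.Vertex) := Quot.finite _

instance : Fintype K.Edge := Fintype.ofFinite _

instance : MeasurableSpace K.Edge := ⊤

end Cube

/-! ### The box with its top and bottom sides -/

/-- The box `Λ` with its two sides `T` and `B`: disjoint sets of boundary vertices lying in the two
halves of the cube cut by the middle hyperplane. Boundary vertices lying exactly on the hyperplane
may be put in `T`, in `B` or in neither. -/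
structure Box (d : ℕ) extends Cube d where
  T : Set toCube.Vertex
  B : Set toCube.Vertex
  disjoint_sides : Disjoint T B
  T_subset : T ⊆ {x | x ∈ toCube.boundary ∧ 0 ≤ toCube.height x}
  B_subset : B ⊆ {x | x ∈ toCube.boundary ∧ toCube.height x ≤ 0}
  subset_T : {x | x ∈ toCube.boundary ∧ 0 < toCube.height x} ⊆ T
  subset_B : {x | x ∈ toCube.boundary ∧ toCube.height x < 0} ⊆ B

namespace Box

variable {d : ℕ} (Λ : Box d)

/-- `|Λ|`, the number of vertices of the box. -/
def card : ℕ := Nat.card Λ.Vertex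

/-- The graph on the vertices of the box whose edges are those of `S`. -/
def subgraphOf (S : Set Λ.Edge) : SimpleGraph Λ.Vertex :=
  SimpleGraph.fromEdgeSet (Subtype.val '' S)

/-- `S` separates `T` and `B`: no connected set of edges of the box outside `S` meets both. -/
def Separates (S : Set Λ.Edge) : Prop :=
  ∀ x ∈ Λ.T, ∀ y ∈ Λ.B, ¬ (Λ.subgraphOf Sᶜ).Reachable x y

/-- A cut: a set of edges separating `T` and `B` which is minimal for the inclusion. -/
def IsCut (S : Set Λ.Edge) : Prop := Minimal Λ.Separates S

/-- Percolation configurations in the box (`true` is open, `false` is closed). -/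
abbrev Config : Type := Λ.Edge → Bool

variable {Λ}

/-- The graph of the open edges. -/
def openGraph (ω : Λ.Config) : SimpleGraph Λ.Vertex := Λ.subgraphOf {e | ω e = true}

/-- The event `T ↔ B`: some open path in the box joins a vertex of `T` to a vertex of `B`. -/
def Connects (ω : Λ.Config) : Prop := ∃ x ∈ Λ.T, ∃ y ∈ Λ.B, (openGraph ω).Reachable x y

open Classical in
/-- `ω^e`: the configuration obtained by opening `e`. -/
def openAt (ω : Λ.Config) (e : Λ.Edge) : Λ.Config := Function.update ω e true

open Classical in
/-- `ω_e`: the configuration obtained by closing `e`. -/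
def closeAt (ω : Λ.Config) (e : Λ.Edge) : Λ.Config := Function.update ω e false

/-- The cuts of a configuration: the cuts of the box all of whose edges are closed. -/
def cuts (ω : Λ.Config) : Set (Set Λ.Edge) := {S | Λ.IsCut S ∧ ∀ f ∈ S, ω f = false}

/-- The pivotal edges of a configuration: those whose opening connects `T` and `B`. -/
def pivotal (ω : Λ.Config) : Set Λ.Edge := {e | Connects (openAt ω e)}

/-! ### The random-cluster measure with `TB` boundary condition -/

/-- The open edges, together with the wiring outside the box: all the vertices of `T` are joined
to each other, and so are all the vertices of `B`. -/
def wiredGraph (ω : Λ.Config) : SimpleGraph Λ.Vertex :=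
  openGraph ω ⊔ SimpleGraph.fromRel (fun x y => (x ∈ Λ.T ∧ y ∈ Λ.T) ∨ (x ∈ Λ.B ∧ y ∈ Λ.B))

/-- The number of open clusters with the `TB` boundary condition. -/
def clusterCount (ω : Λ.Config) : ℕ := Nat.card (wiredGraph ω).ConnectedComponent

/-- The unnormalised random-cluster weight. -/
def weight (p q : ℝ) (ω : Λ.Config) : ℝ :=
  (∏ e : Λ.Edge, if ω e = true then p else 1 - p) * q ^ clusterCount ω

open Classical in
/-- The random-cluster measure `Φ^{TB}_{Λ,p,q}` (probability of a configuration). -/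
def rcProb (p q : ℝ) (ω : Λ.Config) : ℝ := weight p q ω / ∑ ω' : Λ.Config, weight p q ω'

/-! ### The coupled Gibbs sampler -/

/-- The threshold `Φ(ω_e) / (Φ(ω^e) + Φ(ω_e))` below which the edge `e` is closed. -/
def closeProb (p q : ℝ) (ω : Λ.Config) (e : Λ.Edge) : ℝ :=
  rcProb p q (closeAt ω e) / (rcProb p q (openAt ω e) + rcProb p q (closeAt ω e))

open Classical in
/-- One step of the Gibbs sampler `X`, with the chosen edge `e` and the uniform variable `u`. -/
def stepX (p q : ℝ) (ω : Λ.Config) (e : Λ.Edge) (u : ℝ) : Λ.Config :=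
  if closeProb p q ω e ≤ u then openAt ω e else closeAt ω e

open Classical in
/-- One step of the conditioned process `Y`: an edge whose opening would connect `T` and `B` is
closed instead of being opened. -/
def stepY (p q : ℝ) (ω : Λ.Config) (e : Λ.Edge) (u : ℝ) : Λ.Config :=
  if closeProb p q ω e ≤ u ∧ ¬ Connects (openAt ω e) then openAt ω e else closeAt ω e

variable (Λ)

/-- States of the coupled process `(X, Y)`. -/
abbrev State : Type := Λ.Config × Λ.Config

/-- The randomness used in one step: an edge and a number in `[0,1]`. -/
abbrev Noise : Type := Λ.Edge × unitInterval

variable {Λ}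

/-- One step of the coupled process: both coordinates use the same edge and the same uniform. -/
def step (p q : ℝ) (z : Λ.State) (n : Λ.Noise) : Λ.State :=
  (stepX p q z.1 n.1 n.2, stepY p q z.2 n.1 n.2)

/-- The trajectory `(X_t, Y_t)` driven by an initial state and a sequence `(E_t, U_t)`: the pair
`(E_t, U_t)` is used to go from time `t - 1` to time `t`. -/
def trajectory (p q : ℝ) (a : Λ.State × (ℕ → Λ.Noise)) : ℕ → Λ.State
  | 0 => a.1
  | t + 1 => step p q (trajectory p q a t) (a.2 (t + 1))

variable (Λ)

/-- The law of one pair `(E_t, U_t)`: uniform on the edges times uniform on `[0,1]`. -/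
def noiseLaw : Measure Λ.Noise :=
  (uniformOn (Set.univ : Set Λ.Edge)).prod (volume : Measure unitInterval)

/-- The state space of the coupled process: `X` dominates `Y`, and `T`, `B` are not connected
in `Y`. -/
def stateSpace : Set Λ.State := {z | ¬ Connects z.2 ∧ ∀ e, z.2 e = true → z.1 e = true}

/-- `μ` is an equilibrium distribution of the coupled Markov chain on its state space. -/
structure IsEquilibrium (p q : ℝ) (μ : Measure Λ.State) : Prop where
  isProbabilityMeasure : IsProbabilityMeasure μ
  stateSpace_eq_one : μ Λ.stateSpace = 1
  invariant : (μ.prod Λ.noiseLaw).map (fun a => step p q a.1 a.2) = μ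

/-- `P_μ`: the law of the process `(X_t, Y_t)` started from the distribution `μ`, the pairs
`(E_t, U_t)` being independent of each other and of the initial state. -/
def processLaw (p q : ℝ) (μ : Measure Λ.State) : Measure (ℕ → Λ.State) :=
  (μ.prod (Measure.infinitePi fun _ : ℕ => Λ.noiseLaw)).map (trajectory p q)

/-! ### Measurability, so that the image measures above are the intended ones -/

variable {Λ}

lemma measurable_step (p q : ℝ) :
    Measurable (fun a : Λ.State × Λ.Noise => step p q a.1 a.2) := by
  classical
  have hX : ∀ (ω : Λ.Config) (e : Λ.Edge),
      Measurable fun u : unitInterval => stepX p q ω e u := by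
    intro ω e
    have h : MeasurableSet {u : unitInterval | closeProb p q ω e ≤ u} :=
      measurableSet_le measurable_const measurable_subtype_coe
    exact (measurable_const (a := openAt ω e)).ite h (measurable_const (a := closeAt ω e))
  have hY : ∀ (ω : Λ.Config) (e : Λ.Edge),
      Measurable fun u : unitInterval => stepY p q ω e u := by
    intro ω e
    have h : MeasurableSet {u : unitInterval | closeProb p q ω e ≤ u ∧ ¬ Connects (openAt ω e)} :=
      (measurableSet_le measurable_const measurable_subtype_coe).inter (.const _)
    exact (measurable_const (a := openAt ω e)).ite h (measurable_const (a := closeAt ω e))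
  refine measurable_from_prod_countable_right fun z => ?_
  exact measurable_from_prod_countable_right fun e => (hX z.1 e).prodMk (hY z.2 e)

lemma measurable_trajectory (p q : ℝ) :
    Measurable (trajectory p q : Λ.State × (ℕ → Λ.Noise) → ℕ → Λ.State) := by
  refine measurable_pi_lambda _ fun t => ?_
  induction t with
  | zero => exact measurable_fst
  | succ t ih =>
    simp only [trajectory]
    have h : Measurable fun a : Λ.State × (ℕ → Λ.Noise) => a.2 (t + 1) := by fun_prop
    have h2 : Measurable fun a : Λ.State × (ℕ → Λ.Noise) => (trajectory p q a t, a.2 (t + 1)) :=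
      ih.prodMk h
    have h3 := (measurable_step (Λ := Λ) p q).comp h2
    simp only [Function.comp_def] at h3
    exact h3

end Box

end FK

end

namespace FK

/-! ### The lattice -/

/-! For an edge to be pivotal shortly after some closed cut was far from it, many edges near it must
be closed for a reason that is rare when p is close to 1. Put ε = (1-p)q/p, which bounds every
closing threshold (`closeProb_le`). Call an edge weakly closed if it is closed at time t, or is hit
between t and t+s by a uniform variable smaller than ε. A closed edge that is not weakly closed was
kept closed by a refused opening, so it was pivotal at that moment.

Deterministic part (`exists_chain`): if e is pivotal at time t+s, a chain of N+1 distinct weakly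
closed edges, consecutive ones being neighbours, starts at e. Otherwise the cluster K of weakly
closed edges around e is small and lies well inside the box. At the first time an edge of K or its
neighbourhood is pivotal, a closed cut passes through that edge, and all edges of this cut in the
neighbourhood are weakly closed, hence in K. So K would contain an isolated piece of a minimal cut,
which is impossible (`notMem_of_near_closed`): over ℤ/2 such a piece is a closed, compactly
supported 1-cochain; for d ≥ 2 it is the coboundary of a function supported in a small box
(`exists_primitive`), and it can be deleted from the cut.

Probabilistic part: Y is reversible for the random-cluster measure conditioned on disconnection, and
a maximum principle shows that this is its law under μ (`marginal_eq`). Opening an edge within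
distance ℓ of e preserves a closed cut at distance at least ℓ. Hence, given such a cut, each
prescribed edge closed at time t costs a factor ε (`sum_marginal_closed_le`). The later noise is
independent of the state (`trajectory_noise`), and each of the s steps hits a given edge weakly with
probability ε/|E|. Thus n prescribed edges are all weakly closed with conditional probability at
most (ε(1+s/|E|))^n (`weaklyClosed_le`). As s ≤ |Λ| and |Λ| is at most a constant times |E|
(`card_vertex_le`), a union bound over the exponentially many chains with N of order ℓ/(4d) gives
e^{-ℓ} once ε is small. -/

lemma dist_latticePoint_sq {d : ℕ} (x y : Fin d → ℤ) :
    dist (latticePoint x) (latticePoint y) ^ 2 = ((∑ i, (x i - y i) ^ 2 : ℤ) : ℝ) := by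
  rw [EuclideanSpace.dist_eq, Real.sq_sqrt (Finset.sum_nonneg fun i _ => sq_nonneg _)]
  push_cast
  refine Finset.sum_congr rfl fun i _ => ?_
  rw [Real.dist_eq, sq_abs]
  rfl

lemma lattice_adj_add_single {d : ℕ} (x : Fin d → ℤ) (i : Fin d) :
    (lattice d).Adj x (x + Pi.single i 1) := by
  have h := dist_latticePoint_sq x (x + Pi.single i 1)
  have h2 : (∑ j, (x j - (x + Pi.single i 1 : Fin d → ℤ) j) ^ 2 : ℤ) = 1 := by
    rw [Finset.sum_eq_single i]
    · simp
    · intro j _ hj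
      simp [Pi.single_eq_of_ne hj]
    · simp
  rw [h2] at h
  have h3 : dist (latticePoint x) (latticePoint (x + Pi.single i 1)) = 1 := by
    have := dist_nonneg (x := latticePoint x) (y := latticePoint (x + Pi.single i 1))
    push_cast at h
    nlinarith
  exact h3

lemma lattice_adj_cases {d : ℕ} {x y : Fin d → ℤ} (h : (lattice d).Adj x y) :
    ∃ i, y = x + Pi.single i 1 ∨ x = y + Pi.single i 1 := by
  have h0 : dist (latticePoint x) (latticePoint y) = 1 := h
  have h1 := dist_latticePoint_sq x y
  rw [h0] at h1
  have h2 : (∑ i, (x i - y i) ^ 2 : ℤ) = 1 := by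
    rw [one_pow] at h1
    exact_mod_cast h1.symm
  obtain ⟨i, hi⟩ : ∃ i, x i - y i ≠ 0 := by
    by_contra! hc
    simp [hc] at h2
  have h3 : (∑ j ∈ Finset.univ.erase i, (x j - y j) ^ 2 : ℤ) + (x i - y i) ^ 2 = 1 := by
    rw [Finset.sum_erase_add _ _ (Finset.mem_univ i), h2]
  have h4 : 1 ≤ (x i - y i) ^ 2 := by
    have : 0 < (x i - y i) ^ 2 := by positivity
    omega
  have h5 : 0 ≤ (∑ j ∈ Finset.univ.erase i, (x j - y j) ^ 2 : ℤ) :=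
    Finset.sum_nonneg fun j _ => sq_nonneg _
  have h6 : (∑ j ∈ Finset.univ.erase i, (x j - y j) ^ 2 : ℤ) = 0 := by omega
  have h7 : (x i - y i) ^ 2 = 1 := by omega
  have h8 : ∀ j, j ≠ i → x j = y j := by
    intro j hj
    rw [Finset.sum_eq_zero_iff_of_nonneg fun j _ => sq_nonneg _] at h6
    have := h6 j (by simp [hj])
    have := pow_eq_zero_iff (two_ne_zero) |>.1 this
    omega
  rcases sq_eq_sq_iff_eq_or_eq_neg.1 (h7.trans (one_pow 2).symm) with h9 | h9
  · refine ⟨i, Or.inr ?_⟩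
    ext j
    by_cases hj : j = i
    · subst hj; simp; omega
    · simp [Pi.single_eq_of_ne hj, h8 j hj]
  · refine ⟨i, Or.inl ?_⟩
    ext j
    by_cases hj : j = i
    · subst hj; simp; omega
    · simp [Pi.single_eq_of_ne hj, h8 j hj]

/-- For `d ≥ 2`, a closed `ℤ/2`-valued 1-cochain of `ℤ^d` supported in a box is the coboundary of a
function vanishing outside of the box. -/
lemma exists_primitive {d : ℕ} (hd : 2 ≤ d) (χ : (Fin d → ℤ) → Fin d → ZMod 2) (x₀ : Fin d → ℤ)
    (m : ℤ) (hsupp : ∀ x i, χ x i ≠ 0 → ∀ j, |x j - x₀ j| ≤ m)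
    (hsq : ∀ x i j, i ≠ j →
      χ x i + χ (x + Pi.single i 1) j = χ x j + χ (x + Pi.single j 1) i) :
    ∃ b : (Fin d → ℤ) → ZMod 2, (∀ x i, b x + b (x + Pi.single i 1) = χ x i) ∧
      ∀ x, (∃ j, m < |x j - x₀ j|) → b x = 0 := by
  set i₀ : Fin d := ⟨0, by omega⟩ with hi₀
  set i₁ : Fin d := ⟨1, by omega⟩ with hi₁
  have h01 : i₁ ≠ i₀ := by simp [hi₀, hi₁]
  have hz : ∀ x i j, m < |x j - x₀ j| → χ x i = 0 := by
    intro x i j hj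
    by_contra h
    exact absurd (hsupp x i h j) (not_le.2 hj)
  -- The primitive at x is the sum of χ along the ray from x in direction `i₀`, truncated at `N x`,
  -- beyond which the ray has left the support.
  let S : ℕ → (Fin d → ℤ) → ZMod 2 :=
    fun M x => ∑ k ∈ Finset.range M, χ (x + Pi.single i₀ (k : ℤ)) i₀
  let N : (Fin d → ℤ) → ℕ := fun x => (x₀ i₀ + m + 1 - x i₀).toNat
  have hfar : ∀ x (k : ℕ), N x ≤ k → ∀ i, χ (x + Pi.single i₀ (k : ℤ)) i = 0 := by
    intro x k hk i
    refine hz _ _ i₀ (lt_of_lt_of_le ?_ (le_abs_self _))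
    have h1 : x₀ i₀ + m + 1 - x i₀ ≤ (N x : ℤ) := Int.self_le_toNat _
    have h2 : (N x : ℤ) ≤ k := by exact_mod_cast hk
    simp only [Pi.add_apply, Pi.single_eq_same]
    omega
  have hS : ∀ x M, N x ≤ M → S (N x) x = S M x := by
    intro x M hM
    refine Finset.sum_subset (Finset.range_mono hM) fun k _ hk => ?_
    exact hfar x k (by simpa using hk) _
  have htel : ∀ M x j, j ≠ i₀ → S M x + S M (x + Pi.single j 1) =
      χ x j + χ (x + Pi.single i₀ (M : ℤ)) j := by
    intro M x j hj
    induction M with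
    | zero => simp [S, CharTwo.add_self_eq_zero]
    | succ M ih =>
      have e1 : S (M + 1) x = S M x + χ (x + Pi.single i₀ (M : ℤ)) i₀ := Finset.sum_range_succ _ _
      have e2 : S (M + 1) (x + Pi.single j 1) = S M (x + Pi.single j 1) +
          χ (x + Pi.single j 1 + Pi.single i₀ (M : ℤ)) i₀ := Finset.sum_range_succ _ _
      have e3 := hsq (x + Pi.single i₀ (M : ℤ)) i₀ j hj.symm
      have e4 : x + Pi.single i₀ (M : ℤ) + Pi.single i₀ 1 =
          x + Pi.single i₀ ((M + 1 : ℕ) : ℤ) := by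
        rw [add_assoc, ← Pi.single_add]; push_cast; rfl
      have e5 : x + Pi.single j 1 + Pi.single i₀ (M : ℤ) =
          x + Pi.single i₀ (M : ℤ) + Pi.single j 1 := by abel
      rw [e4] at e3
      rw [e1, e2, e5]
      have e6 : ∀ a b c u v w z : ZMod 2, a + b = c + u → v + w = u + z →
          a + v + (b + z) = c + w := by decide
      exact e6 _ _ _ _ _ _ _ ih e3
  have hrec : ∀ M x, S M x + S M (x + Pi.single i₀ 1) =
      χ x i₀ + χ (x + Pi.single i₀ (M : ℤ)) i₀ := by
    intro M x
    have e1 : S M (x + Pi.single i₀ 1) =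
        ∑ k ∈ Finset.range M, χ (x + Pi.single i₀ ((k + 1 : ℕ) : ℤ)) i₀ := by
      refine Finset.sum_congr rfl fun k _ => ?_
      rw [add_assoc, ← Pi.single_add, add_comm (1 : ℤ)]; push_cast; rfl
    have e2 := Finset.sum_range_succ (fun k : ℕ => χ (x + Pi.single i₀ (k : ℤ)) i₀) M
    have e3 := Finset.sum_range_succ' (fun k : ℕ => χ (x + Pi.single i₀ (k : ℤ)) i₀) M
    rw [e1]
    have e4 : S M x + χ (x + Pi.single i₀ (M : ℤ)) i₀ =
        (∑ k ∈ Finset.range M, χ (x + Pi.single i₀ ((k + 1 : ℕ) : ℤ)) i₀) + χ x i₀ := by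
      rw [← e2, e3]; simp
    have e6 : ∀ a b c u : ZMod 2, a + b = c + u → a + c = u + b := by decide
    exact e6 _ _ _ _ e4
  have hb : ∀ x i, S (N x) x + S (N (x + Pi.single i 1)) (x + Pi.single i 1) = χ x i := by
    intro x i
    have hM1 := le_max_left (N x) (N (x + Pi.single i 1))
    have hM2 := le_max_right (N x) (N (x + Pi.single i 1))
    rw [hS x _ hM1, hS _ _ hM2]
    have hf := hfar x _ hM1 i
    by_cases hi : i = i₀
    · subst hi
      rw [hrec, hf, add_zero]
    · rw [htel _ _ _ hi, hf, add_zero]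
  have hside : ∀ x j, j ≠ i₀ → m < |x j - x₀ j| → S (N x) x = 0 := by
    intro x j hj hm
    refine Finset.sum_eq_zero fun k _ => hz _ _ j ?_
    simpa [Pi.single_eq_of_ne hj] using hm
  refine ⟨fun x => S (N x) x, hb, ?_⟩
  rintro x ⟨j, hj⟩
  by_cases hji : j = i₀
  · subst hji
    rcases lt_abs.1 hj with h | h
    · have : N x = 0 := by simp only [N]; omega
      simp [this, S]
    -- Behind the box the ray may cross the support. Sliding x in direction `i₁` stays behind the
    -- box, where χ vanishes, so the primitive is constant; eventually the ray misses the box. A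
    -- second direction is indispensable here.
    · have hk : ∀ k : ℕ, S (N x) x =
          S (N (x + Pi.single i₁ (k : ℤ))) (x + Pi.single i₁ (k : ℤ)) := by
        intro k
        induction k with
        | zero => simp
        | succ k ih =>
          have e1 := hb (x + Pi.single i₁ (k : ℤ)) i₁
          have e2 : χ (x + Pi.single i₁ (k : ℤ)) i₁ = 0 := by
            refine hz _ _ i₀ ?_
            simpa [Pi.single_eq_of_ne h01.symm] using hj
          have e3 : x + Pi.single i₁ (k : ℤ) + Pi.single i₁ 1 =
              x + Pi.single i₁ ((k + 1 : ℕ) : ℤ) := by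
            rw [add_assoc, ← Pi.single_add]; push_cast; rfl
          rw [e2, e3, ← ih] at e1
          exact CharTwo.add_eq_zero.1 e1
      obtain ⟨k, hk'⟩ : ∃ k : ℕ, m < x i₁ + k - x₀ i₁ :=
        ⟨(m + x₀ i₁ - x i₁ + 1).toNat, by
          have := Int.self_le_toNat (m + x₀ i₁ - x i₁ + 1); omega⟩
      change S (N x) x = 0
      rw [hk k]
      refine hside _ i₁ h01 (lt_of_lt_of_le ?_ (le_abs_self _))
      simpa using hk'
  · exact hside x j hji hj

/-! ### Edges of the box and their proximity -/

namespace Cube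

variable {d : ℕ} (K : Cube d)

/-- Two edges are near each other when they have endpoints at `ℓ^∞` distance at most `1`. -/
def Near {K : Cube d} (f g : K.Edge) : Prop :=
  ∃ x ∈ f.1, ∃ y ∈ g.1, ∀ i, |x.1 i - y.1 i| ≤ 1

/-- The edge of the box between two adjacent vertices. -/
def mkEdge {K : Cube d} (x y : K.Vertex) (h : (lattice d).Adj x.1 y.1) : K.Edge := ⟨s(x, y), h⟩

lemma Edge.exists_eq_mkEdge {K : Cube d} (f : K.Edge) : ∃ x y h, f = mkEdge x y h := by
  obtain ⟨f, hf⟩ := f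
  induction f with
  | _ x y => exact ⟨x, y, hf, rfl⟩

lemma Edge.abs_sub_le_one {K : Cube d} (f : K.Edge) {x y : K.Vertex} (hx : x ∈ f.1)
    (hy : y ∈ f.1) (i : Fin d) : |x.1 i - y.1 i| ≤ 1 := by
  obtain ⟨u, v, h, rfl⟩ := f.exists_eq_mkEdge
  have key : |u.1 i - v.1 i| ≤ 1 := by
    obtain ⟨j, hj | hj⟩ := lattice_adj_cases h <;> rw [hj] <;> by_cases hij : i = j
    · subst hij; simp
    · simp [Pi.single_eq_of_ne hij]
    · subst hij; simp
    · simp [Pi.single_eq_of_ne hij]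
  simp only [mkEdge, Sym2.mem_iff] at hx hy
  rcases hx with rfl | rfl <;> rcases hy with rfl | rfl
  · simp
  · exact key
  · rwa [abs_sub_comm]
  · simp

end Cube

/-! ### Minimal cuts as edge boundaries over ℤ/2 -/

namespace Box

variable {d : ℕ} {Λ : Box d}

open _root_.FK.Cube

lemma subgraphOf_adj {S : Set Λ.Edge} {x y : Λ.Vertex} :
    (Λ.subgraphOf S).Adj x y ↔ ∃ h : (lattice d).Adj x.1 y.1, mkEdge x y h ∈ S := by
  simp only [subgraphOf, SimpleGraph.fromEdgeSet_adj, Set.mem_image]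
  constructor
  · rintro ⟨⟨f, hf, hfe⟩, -⟩
    have hf2 := f.2
    rw [hfe] at hf2
    refine ⟨hf2, ?_⟩
    have : f = mkEdge x y hf2 := Subtype.ext hfe
    rwa [← this]
  · rintro ⟨h, hS⟩
    refine ⟨⟨_, hS, rfl⟩, ?_⟩
    rintro rfl
    exact (lattice d).loopless.irrefl _ h

/-- A set of vertices closed under the adjacency of a graph contains the vertices reachable from
its elements. -/
lemma _root_.SimpleGraph.Reachable.mem_of_forall_adj {V : Type*} {G : SimpleGraph V} {A : Set V}
    (hA : ∀ x y, G.Adj x y → x ∈ A → y ∈ A) {x y : V} (h : G.Reachable x y) (hx : x ∈ A) :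
    y ∈ A := by
  obtain ⟨w⟩ := h
  induction w with
  | nil => exact hx
  | cons hadj _ ih => exact ih (hA _ _ hadj hx)

/-- A set of edges separates as soon as it contains the edge boundary of a set of vertices
containing `T` and disjoint from `B`. -/
lemma separates_of_boundary {S : Set Λ.Edge} (A : Set Λ.Vertex) (hT : Λ.T ⊆ A)
    (hB : ∀ x ∈ Λ.B, x ∉ A)
    (hS : ∀ (x y : Λ.Vertex) (h : (lattice d).Adj x.1 y.1), mkEdge x y h ∉ S → x ∈ A → y ∈ A) :
    Λ.Separates S := by
  intro x hx y hy hr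
  have hxA : x ∈ A := hT hx
  refine hB y hy (hr.mem_of_forall_adj (A := A) (fun u v huv hu => ?_) hxA)
  obtain ⟨h, hm⟩ := subgraphOf_adj.1 huv
  exact hS u v h hm hu

/-- A cut is the edge boundary of a set of vertices containing `T` and disjoint from `B`. -/
lemma IsCut.exists_side {c : Set Λ.Edge} (hc : Λ.IsCut c) :
    ∃ A : Set Λ.Vertex, Λ.T ⊆ A ∧ (∀ x ∈ Λ.B, x ∉ A) ∧
      ∀ (x y : Λ.Vertex) (h : (lattice d).Adj x.1 y.1), mkEdge x y h ∉ c ↔ (x ∈ A ↔ y ∈ A) := by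
  -- The side A is the set of vertices joined to T without using c.
  have hT : Λ.T ⊆ {v | ∃ x ∈ Λ.T, (Λ.subgraphOf cᶜ).Reachable x v} :=
    fun x hx => ⟨x, hx, SimpleGraph.Reachable.refl x⟩
  have hB : ∀ y ∈ Λ.B, y ∉ {v | ∃ x ∈ Λ.T, (Λ.subgraphOf cᶜ).Reachable x v} := by
    rintro y hy ⟨x, hx, hr⟩
    exact hc.1 x hx y hy hr
  refine ⟨_, hT, hB, ?_⟩
  have hstep : ∀ (x y : Λ.Vertex) (h : (lattice d).Adj x.1 y.1), mkEdge x y h ∉ c →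
      (∃ z ∈ Λ.T, (Λ.subgraphOf cᶜ).Reachable z x) →
      (∃ z ∈ Λ.T, (Λ.subgraphOf cᶜ).Reachable z y) := by
    rintro x y h hm ⟨z, hz, hr⟩
    exact ⟨z, hz, hr.trans (SimpleGraph.Adj.reachable (subgraphOf_adj.2 ⟨h, hm⟩))⟩
  have hsymm : ∀ (x y : Λ.Vertex) (h : (lattice d).Adj x.1 y.1), mkEdge y x h.symm = mkEdge x y h :=
    fun x y h => Subtype.ext Sym2.eq_swap
  intro x y h
  refine ⟨fun hm => ⟨hstep x y h hm, hstep y x h.symm (by rwa [hsymm])⟩, fun hxy hm => ?_⟩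
  -- An edge of c with both ends on the same side of A is superfluous: without it, c still contains
  -- the edge boundary of A. This contradicts minimality.
  have hsep : Λ.Separates (c \ {mkEdge x y h}) := by
    refine separates_of_boundary _ hT hB ?_
    intro u v huv hn hu
    by_cases huc : mkEdge u v huv ∈ c
    · have he : mkEdge u v huv = mkEdge x y h := by
        by_contra hne
        exact hn ⟨huc, hne⟩
      have := congrArg Subtype.val he
      simp only [mkEdge, Sym2.eq_iff] at this
      rcases this with ⟨rfl, rfl⟩ | ⟨rfl, rfl⟩
      · exact hxy.1 hu
      · exact hxy.2 hu
    · exact hstep u v huv huc hu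
  have := hc.2 hsep Set.sdiff_subset hm
  exact this.2 rfl

/-- A set of edges lying well inside the box cannot be a union of components, for the relation
`Near`, of a cut. -/
lemma IsCut.notMem_of_near_closed (hd : 2 ≤ d) {c : Set Λ.Edge} (hc : Λ.IsCut c)
    (x₀ : Fin d → ℤ) (m : ℤ)
    (hbox : ∀ y : Fin d → ℤ, (∀ i, |y i - x₀ i| ≤ m + 1) → latticePoint y ∈ Λ.carrier)
    (K : Set Λ.Edge) (hK : ∀ f ∈ K, ∀ x ∈ f.1, ∀ i, |x.1 i - x₀ i| ≤ m)
    (hN : ∀ f ∈ K, ∀ g ∈ c, Near f g → g ∈ K) : ∀ f ∈ c, f ∉ K := by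
  classical
  obtain ⟨A, hTA, hBA, hA⟩ := hc.exists_side
  -- χ is the indicator of c ∩ K as a 1-cochain, and `a` below is the indicator of A. On edges of
  -- the box the coboundary of `a` is the indicator of c.
  let χ : (Fin d → ℤ) → Fin d → ZMod 2 := fun x i =>
    if ∃ f : Λ.Edge, f ∈ c ∧ f ∈ K ∧ f.1.map Subtype.val = s(x, x + Pi.single i 1) then 1 else 0
  let a : (Fin d → ℤ) → ZMod 2 := fun y => if ∃ h : latticePoint y ∈ Λ.carrier, ⟨y, h⟩ ∈ A then 1
    else 0
  have hmap : ∀ (f : Λ.Edge) x y, f.1.map Subtype.val = s(x, y) →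
      ∃ (hx : latticePoint x ∈ Λ.carrier) (hy : latticePoint y ∈ Λ.carrier)
        (h : (lattice d).Adj x y), f = mkEdge ⟨x, hx⟩ ⟨y, hy⟩ h := by
    intro f x y h
    obtain ⟨u, v, huv, rfl⟩ := f.exists_eq_mkEdge
    simp only [mkEdge, Sym2.map_mk, Sym2.eq_iff] at h
    rcases h with ⟨rfl, rfl⟩ | ⟨rfl, rfl⟩
    · exact ⟨u.2, v.2, huv, rfl⟩
    · exact ⟨v.2, u.2, huv.symm, Subtype.ext Sym2.eq_swap⟩
  have hone : ∀ x i, χ x i ≠ 0 → ∃ f : Λ.Edge, f ∈ c ∧ f ∈ K ∧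
      f.1.map Subtype.val = s(x, x + Pi.single i 1) := by
    intro x i h
    by_contra hne
    exact h (if_neg hne)
  have ha : ∀ (x y : Λ.Vertex), (a x.1 = a y.1) ↔ (x ∈ A ↔ y ∈ A) := by
    intro x y
    have h1 : ∀ z : Λ.Vertex, a z.1 = if z ∈ A then 1 else 0 := by
      intro z
      simp only [a]
      congr 1
      exact propext ⟨fun ⟨_, h⟩ => h, fun h => ⟨z.2, h⟩⟩
    rw [h1, h1]
    by_cases hx : x ∈ A <;> by_cases hy : y ∈ A <;> simp [hx, hy]
  have hχ0 : ∀ (x y : Λ.Vertex) (h : (lattice d).Adj x.1 y.1) i, y.1 = x.1 + Pi.single i 1 →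
      (mkEdge x y h ∈ c → mkEdge x y h ∈ K) → χ x.1 i = a x.1 + a y.1 := by
    intro x y h i hi hcK
    by_cases hm : mkEdge x y h ∈ c
    · have h1 : χ x.1 i = 1 := if_pos ⟨_, hm, hcK hm, by simp [mkEdge, hi]⟩
      have h2 : a x.1 ≠ a y.1 := by
        rw [Ne, ha, ← hA x y h]
        exact not_not.2 hm
      rw [h1]
      have : ∀ u v : ZMod 2, u ≠ v → 1 = u + v := by decide
      exact this _ _ h2
    · have h1 : χ x.1 i = 0 := by
        refine if_neg ?_
        rintro ⟨f, hfc, -, hf⟩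
        rw [← hi] at hf
        obtain ⟨_, _, _, rfl⟩ := hmap f _ _ hf
        exact hm hfc
      have h2 : a x.1 = a y.1 := by rwa [ha, ← hA x y h]
      rw [h1, h2, CharTwo.add_self_eq_zero]
  have hsupp : ∀ x i, χ x i ≠ 0 → ∀ j, |x j - x₀ j| ≤ m := by
    intro x i h
    obtain ⟨f, -, hfK, hf⟩ := hone x i h
    obtain ⟨hx, hy, hxy, rfl⟩ := hmap f _ _ hf
    exact hK _ hfK ⟨x, hx⟩ (by simp [mkEdge])
  -- Next to an edge of c ∩ K, χ coincides with the coboundary of `a`: the edges there belong to the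
  -- box by `hbox`, and those lying in c belong to K by `hN`.
  have hχ1 : ∀ y i (z : Fin d → ℤ) k, χ z k ≠ 0 → (∀ j, |y j - z j| ≤ 1) →
      (∀ j, |(y + Pi.single i 1 : Fin d → ℤ) j - z j| ≤ 1) →
      χ y i = a y + a (y + Pi.single i 1) := by
    intro y i z k hz hy hy'
    have hzm := hsupp z k hz
    obtain ⟨f, hfc, hfK, hf⟩ := hone z k hz
    obtain ⟨hx, hx', hxy, rfl⟩ := hmap f _ _ hf
    have hin : ∀ w : Fin d → ℤ, (∀ j, |w j - z j| ≤ 1) → latticePoint w ∈ Λ.carrier := by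
      intro w hw
      refine hbox w fun j => ?_
      have h1 := abs_le.1 (hw j)
      have h2 := abs_le.1 (hzm j)
      exact abs_le.2 ⟨by omega, by omega⟩
    refine hχ0 ⟨y, hin y hy⟩ ⟨y + Pi.single i 1, hin _ hy'⟩ (lattice_adj_add_single y i) i rfl ?_
    intro hmc
    refine hN _ hfK _ hmc ⟨⟨z, hx⟩, by simp [mkEdge], ⟨y, hin y hy⟩, by simp [mkEdge], fun j => ?_⟩
    rw [abs_sub_comm]
    exact hy j
  have hsq : ∀ x i j, i ≠ j →
      χ x i + χ (x + Pi.single i 1) j = χ x j + χ (x + Pi.single j 1) i := by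
    intro x i j hij
    -- Closedness on a square: either χ vanishes on all four sides, or some side is in c ∩ K, and
    -- then χ is a coboundary on the whole square, whose corners are all within ℓ^∞ distance 1 of z.
    by_cases h0 : χ x i = 0 ∧ χ (x + Pi.single i 1) j = 0 ∧ χ x j = 0 ∧
        χ (x + Pi.single j 1) i = 0
    · obtain ⟨h1, h2, h3, h4⟩ := h0
      rw [h1, h2, h3, h4]
    · obtain ⟨z, k, hz, hzc⟩ : ∃ z k, χ z k ≠ 0 ∧ ∃ (r s : ℤ), (r = 0 ∨ r = 1) ∧
          (s = 0 ∨ s = 1) ∧ z = x + Pi.single i r + Pi.single j s := by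
        by_contra! hne
        refine h0 ⟨?_, ?_, ?_, ?_⟩ <;> by_contra h
        · exact hne _ _ h 0 0 (by simp) (by simp) (by simp)
        · exact hne _ _ h 1 0 (by simp) (by simp) (by simp)
        · exact hne _ _ h 0 0 (by simp) (by simp) (by simp)
        · exact hne _ _ h 0 1 (by simp) (by simp) (by simp)
      obtain ⟨r, s, hr, hs, rfl⟩ := hzc
      have hcorner : ∀ (u v : ℤ), (u = 0 ∨ u = 1) → (v = 0 ∨ v = 1) → ∀ l,
          |(x + Pi.single i u + Pi.single j v : Fin d → ℤ) l -
            (x + Pi.single i r + Pi.single j s : Fin d → ℤ) l| ≤ 1 := by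
        intro u v hu hv l
        by_cases hli : l = i
        · subst hli
          simp only [Pi.add_apply, Pi.single_eq_same, Pi.single_eq_of_ne hij]
          rw [abs_le]; omega
        · by_cases hlj : l = j
          · subst hlj
            simp only [Pi.add_apply, Pi.single_eq_same, Pi.single_eq_of_ne hli]
            rw [abs_le]; omega
          · simp [Pi.single_eq_of_ne hli, Pi.single_eq_of_ne hlj]
      have c00 := hcorner 0 0 (by simp) (by simp)
      have c10 := hcorner 1 0 (by simp) (by simp)
      have c01 := hcorner 0 1 (by simp) (by simp)
      have c11 := hcorner 1 1 (by simp) (by simp)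
      simp only [Pi.single_zero, add_zero] at c00 c10 c01
      have c11' := c11
      rw [add_right_comm x] at c11'
      rw [hχ1 x i _ k hz c00 c10, hχ1 _ j _ k hz c10 c11, hχ1 x j _ k hz c00 c01,
        hχ1 _ i _ k hz c01 c11', add_right_comm x (Pi.single j 1)]
      have : ∀ s t u v : ZMod 2, s + t + (t + u) = s + v + (v + u) := by decide
      exact this _ _ _ _
  obtain ⟨b, hb, hb0⟩ := exists_primitive hd χ x₀ m hsupp hsq
  -- A boundary vertex has a neighbour outside the cube, so it cannot lie in the box of radius m,
  -- whose enlargement by 1 is inside the cube.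
  have hbdry : ∀ x ∈ Λ.boundary, b x.1 = 0 := by
    rintro x ⟨y, hy, hxy⟩
    refine hb0 _ ?_
    by_contra! hx
    refine hy (hbox y fun i => ?_)
    have h1 := abs_le.1 (hx i)
    obtain ⟨j, hj | hj⟩ := lattice_adj_cases hxy
    · have h2 : y i = x.1 i + (Pi.single j 1 : Fin d → ℤ) i := by rw [hj]; rfl
      by_cases hij : i = j
      · subst hij
        rw [Pi.single_eq_same] at h2
        rw [abs_le]; omega
      · rw [Pi.single_eq_of_ne hij] at h2
        rw [abs_le]; omega
    · have h2 : x.1 i = y i + (Pi.single j 1 : Fin d → ℤ) i := by rw [hj]; rfl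
      by_cases hij : i = j
      · subst hij
        rw [Pi.single_eq_same] at h2
        rw [abs_le]; omega
      · rw [Pi.single_eq_of_ne hij] at h2
        rw [abs_le]; omega
  have haA : ∀ z : Λ.Vertex, a z.1 = 1 ↔ z ∈ A := by
    intro z
    by_cases hz : z ∈ A
    · simp only [hz, iff_true]
      exact if_pos ⟨z.2, hz⟩
    · simp only [hz, iff_false]
      have : a z.1 = 0 := if_neg fun ⟨_, h⟩ => hz h
      rw [this]; decide
  -- Adding b to `a` erases the part of the boundary lying in K without changing the values on T and
  -- B. Minimality of c then forces c ∩ K to be empty.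
  have hsep : Λ.Separates (c \ K) := by
    refine separates_of_boundary {v | a v.1 + b v.1 = 1} ?_ ?_ ?_
    · intro x hx
      have h1 : a x.1 = 1 := (haA x).2 (hTA hx)
      simp [h1, hbdry x (Λ.T_subset hx).1]
    · intro x hx h
      have h1 : a x.1 ≠ 1 := fun h => hBA x hx ((haA x).1 h)
      simp only [Set.mem_ofPred_eq, hbdry x (Λ.B_subset hx).1, add_zero] at h
      exact h1 h
    · intro x y h hn hx
      have key : ∀ (x y : Λ.Vertex) (h : (lattice d).Adj x.1 y.1) i,
          y.1 = x.1 + Pi.single i 1 → mkEdge x y h ∉ c \ K → a x.1 + b x.1 = a y.1 + b y.1 := by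
        intro x y h i hi hn
        have h1 := hχ0 x y h i hi fun hm => by
          by_contra hk
          exact hn ⟨hm, hk⟩
        have h2 := hb x.1 i
        rw [← hi, h1] at h2
        have : ∀ u v w z : ZMod 2, u + v = w + z → w + u = z + v := by decide
        exact this _ _ _ _ h2
      obtain ⟨i, hi | hi⟩ := lattice_adj_cases h
      · exact (key x y h i hi hn).symm.trans hx
      · refine (key y x h.symm i hi ?_).trans hx
        have : mkEdge y x h.symm = mkEdge x y h := Subtype.ext Sym2.eq_swap
        rwa [this]
  intro f hf
  exact (hc.2 hsep Set.sdiff_subset hf).2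

/-! ### Deterministic analysis of the dynamics -/

lemma Separates.mono {S S' : Set Λ.Edge} (h : Λ.Separates S) (hS : S ⊆ S') : Λ.Separates S' := by
  intro x hx y hy hr
  refine h x hx y hy (hr.mono fun u v huv => ?_)
  obtain ⟨h1, h2⟩ := subgraphOf_adj.1 huv
  exact subgraphOf_adj.2 ⟨h1, fun h3 => h2 (hS h3)⟩

lemma connects_iff (ω : Λ.Config) : Connects ω ↔ ¬ Λ.Separates {f | ω f = false} := by
  have : {f | ω f = true} = {f | ω f = false}ᶜ := by
    ext f
    simp
  simp only [Connects, Separates, openGraph, this]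
  push Not
  rfl

lemma not_connects_of_separates {ω : Λ.Config} {S : Set Λ.Edge} (hS : Λ.Separates S)
    (h : ∀ f ∈ S, ω f = false) : ¬ Connects ω := by
  rw [connects_iff, not_not]
  exact hS.mono h

@[simp] lemma openAt_self (ω : Λ.Config) (e : Λ.Edge) : openAt ω e e = true := by simp [openAt]

@[simp] lemma closeAt_self (ω : Λ.Config) (e : Λ.Edge) : closeAt ω e e = false := by simp [closeAt]

lemma openAt_of_ne (ω : Λ.Config) {e f : Λ.Edge} (h : f ≠ e) : openAt ω e f = ω f := by
  simp [openAt, h]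

lemma closeAt_of_ne (ω : Λ.Config) {e f : Λ.Edge} (h : f ≠ e) : closeAt ω e f = ω f := by
  simp [closeAt, h]

lemma not_connects_closeAt {ω : Λ.Config} (h : ¬ Connects ω) (e : Λ.Edge) :
    ¬ Connects (closeAt ω e) := by
  rw [connects_iff, not_not] at h
  refine not_connects_of_separates h fun f hf => ?_
  by_cases hfe : f = e
  · subst hfe; simp
  · rwa [closeAt_of_ne _ hfe]

lemma not_connects_stepY {p q : ℝ} {ω : Λ.Config} (h : ¬ Connects ω) (e : Λ.Edge) (u : ℝ) :
    ¬ Connects (stepY p q ω e u) := by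
  unfold stepY
  split_ifs with h1
  · exact h1.2
  · exact not_connects_closeAt h e

lemma pivotal_eq_false {ω : Λ.Config} (h : ¬ Connects ω) {e : Λ.Edge} (he : e ∈ pivotal ω) :
    ω e = false := by
  by_contra hc
  have : openAt ω e = ω := by
    funext f
    by_cases hf : f = e
    · subst hf; simpa using hc
    · rw [openAt_of_ne _ hf]
  exact h (this ▸ he)

/-- An edge outside of a closed cut is not pivotal. -/
lemma notMem_pivotal_of_cut {ω : Λ.Config} {c : Set Λ.Edge} (hc : c ∈ cuts ω) {e : Λ.Edge}
    (he : e ∉ c) : e ∉ pivotal ω := by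
  refine not_connects_of_separates hc.1.1 fun f hf => ?_
  rw [openAt_of_ne _ (by rintro rfl; exact he hf)]
  exact hc.2 f hf

/-- A pivotal edge lies on a closed cut. -/
lemma exists_cut_of_mem_pivotal {ω : Λ.Config} (h : ¬ Connects ω) {e : Λ.Edge}
    (he : e ∈ pivotal ω) : ∃ c ∈ cuts ω, e ∈ c := by
  rw [connects_iff, not_not] at h
  obtain ⟨c, hc, hmin⟩ := exists_minimal_le_of_wellFoundedLT Λ.Separates _ h
  have hcut : c ∈ cuts ω := ⟨hmin, fun f hf => hc hf⟩
  refine ⟨c, hcut, ?_⟩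
  by_contra hec
  exact notMem_pivotal_of_cut hcut hec he

/-! ### Weakly closed edges and the chains they form -/

/-- The edges closed at the beginning, or closed at some time up to `s` because of a small uniform
variable. -/
def weaklyClosed (ε : ℝ) (s : ℕ) (ω : Λ.Config) (n : ℕ → Λ.Noise) : Set Λ.Edge :=
  {f | ω f = false ∨ ∃ k, 1 ≤ k ∧ k ≤ s ∧ (n k).1 = f ∧ ((n k).2 : ℝ) < ε}

lemma weaklyClosed_mono {ε : ℝ} {s s' : ℕ} (h : s ≤ s') (ω : Λ.Config) (n : ℕ → Λ.Noise) :
    weaklyClosed ε s ω n ⊆ weaklyClosed ε s' ω n := by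
  rintro f (hf | ⟨k, h1, h2, h3⟩)
  · exact Or.inl hf
  · exact Or.inr ⟨k, h1, h2.trans h, h3⟩

/-- `y` is a trajectory of the process `Y` driven by the noise `n`. -/
def IsYTrajectory (p q : ℝ) (y : ℕ → Λ.Config) (n : ℕ → Λ.Noise) : Prop :=
  ∀ k, y (k + 1) = stepY p q (y k) (n (k + 1)).1 (n (k + 1)).2

section

variable {p q ε : ℝ} {y : ℕ → Λ.Config} {n : ℕ → Λ.Noise}

lemma IsYTrajectory.not_connects (hy : IsYTrajectory p q y n) (h0 : ¬ Connects (y 0)) (k : ℕ) :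
    ¬ Connects (y k) := by
  induction k with
  | zero => exact h0
  | succ k ih => rw [hy k]; exact not_connects_stepY ih _ _

/-- As long as no edge of `M` is pivotal, the closed edges of `M` are weakly closed. -/
lemma IsYTrajectory.mem_weaklyClosed (hy : IsYTrajectory p q y n)
    (hε : ∀ (ω : Λ.Config) (e : Λ.Edge), closeProb p q ω e ≤ ε) {M : Set Λ.Edge} {r : ℕ}
    (hr : ∀ k < r, ∀ f ∈ M, f ∉ pivotal (y k)) :
    ∀ k ≤ r, ∀ f ∈ M, y k f = false → f ∈ weaklyClosed ε k (y 0) n := by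
  intro k
  induction k with
  | zero => exact fun _ f _ hf => Or.inl hf
  | succ k ih =>
    intro hk f hf hc
    by_cases hfe : f = (n (k + 1)).1
    · by_cases hu : ((n (k + 1)).2 : ℝ) < ε
      · exact Or.inr ⟨k + 1, by omega, le_rfl, hfe.symm, hu⟩
      -- A uniform variable at least ε is above the threshold, so the edge opens unless it is
      -- pivotal, which `hr` excludes.
      · exfalso
        have h1 : closeProb p q (y k) (n (k + 1)).1 ≤ (n (k + 1)).2 :=
          (hε _ _).trans (not_lt.1 hu)
        have h2 : ¬ Connects (openAt (y k) (n (k + 1)).1) := by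
          rw [← hfe]
          exact hr k (by omega) f hf
        rw [hy k, stepY, if_pos ⟨h1, h2⟩, hfe, openAt_self] at hc
        exact absurd hc (by decide)
    · refine weaklyClosed_mono (Nat.le_succ k) _ _ (ih (by omega) f hf ?_)
      rw [hy k, stepY] at hc
      split_ifs at hc
      · rwa [openAt_of_ne _ hfe] at hc
      · rwa [closeAt_of_ne _ hfe] at hc

/-- At the first time when an edge of `M` is pivotal, the closed edges of `M` are weakly closed. -/
lemma IsYTrajectory.exists_first_pivotal (hy : IsYTrajectory p q y n)
    (hε : ∀ (ω : Λ.Config) (e : Λ.Edge), closeProb p q ω e ≤ ε) {M : Set Λ.Edge} {s : ℕ}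
    {f : Λ.Edge} (hf : f ∈ M) (hfs : f ∈ pivotal (y s)) :
    ∃ r ≤ s, ∃ g ∈ M, g ∈ pivotal (y r) ∧
      ∀ f ∈ M, y r f = false → f ∈ weaklyClosed ε s (y 0) n := by
  classical
  have hex : ∃ r, ∃ g ∈ M, g ∈ pivotal (y r) := ⟨s, f, hf, hfs⟩
  have hle : Nat.find hex ≤ s := Nat.find_min' hex ⟨f, hf, hfs⟩
  obtain ⟨g, hg, hgp⟩ := Nat.find_spec hex
  refine ⟨Nat.find hex, hle, g, hg, hgp, fun f hf hc => ?_⟩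
  refine weaklyClosed_mono hle _ _ (hy.mem_weaklyClosed hε (fun k hk f hf hp => ?_) _ le_rfl f hf hc)
  exact Nat.find_min hex hk ⟨f, hf, hp⟩

/-- The graph of the relation `Near` on a set of edges. -/
def nearGraph (W : Set Λ.Edge) : SimpleGraph Λ.Edge where
  Adj f g := f ≠ g ∧ Near f g ∧ f ∈ W ∧ g ∈ W
  symm := ⟨fun f g ⟨h1, ⟨x, hx, z, hz, h⟩, h2, h3⟩ =>
    ⟨h1.symm, ⟨z, hz, x, hx, fun i => by rw [abs_sub_comm]; exact h i⟩, h3, h2⟩⟩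
  loopless := ⟨fun f h => h.1 rfl⟩

/-- Each step costs at most 2 in ℓ^∞ distance, one for crossing an edge and one for the gap allowed
by `Near`; the final 1 crosses the last edge. -/
lemma abs_sub_le_of_walk {W : Set Λ.Edge} {f g : Λ.Edge} (w : (nearGraph W).Walk f g) :
    ∀ x ∈ f.1, ∀ z ∈ g.1, ∀ i, |x.1 i - z.1 i| ≤ 2 * w.length + 1 := by
  induction w with
  | nil =>
    intro x hx z hz i
    simpa using Edge.abs_sub_le_one _ hx hz i
  | cons h w ih =>
    intro x hx z hz i
    obtain ⟨a, ha, b, hb, hab⟩ := h.2.1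
    have h1 := abs_le.1 (Edge.abs_sub_le_one _ hx ha i)
    have h2 := abs_le.1 (hab i)
    have h3 := abs_le.1 (ih b hb z hz i)
    rw [SimpleGraph.Walk.length_cons]
    push_cast
    rw [abs_le]
    omega

lemma mem_of_walk {W : Set Λ.Edge} {f g : Λ.Edge} (w : (nearGraph W).Walk f g) (hf : f ∈ W) :
    ∀ h ∈ w.support, h ∈ W := by
  induction w with
  | nil => simpa using hf
  | cons h w ih =>
    intro k hk
    rw [SimpleGraph.Walk.support_cons, List.mem_cons] at hk
    rcases hk with rfl | hk
    · exact hf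
    · exact ih h.2.2.2 k hk

/-- A pivotal edge far from the boundary is the origin of a chain of distinct weakly closed
edges. -/
theorem IsYTrajectory.exists_chain (hd : 2 ≤ d) (hy : IsYTrajectory p q y n)
    (hε : ∀ (ω : Λ.Config) (e : Λ.Edge), closeProb p q ω e ≤ ε) (h0 : ¬ Connects (y 0))
    {s : ℕ} {e : Λ.Edge} (he : e ∈ pivotal (y s)) {x₀ : Λ.Vertex} (hx₀ : x₀ ∈ e.1) (N : ℕ)
    (hbox : N ≠ 0 → ∀ z : Fin d → ℤ, (∀ i, |z i - x₀.1 i| ≤ 2 * N + 1) →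
      latticePoint z ∈ Λ.carrier) :
    ∃ l : List Λ.Edge, (e :: l).IsChain Near ∧ (e :: l).Nodup ∧ l.length = N ∧
      ∀ f ∈ e :: l, f ∈ weaklyClosed ε s (y 0) n ∧
        ∀ x ∈ f.1, ∀ i, |x.1 i - x₀.1 i| ≤ 2 * N + 1 := by
  classical
  set W := weaklyClosed ε s (y 0) n with hW
  have heW : e ∈ W := by
    obtain ⟨r, -, g, hg, hgp, h⟩ := hy.exists_first_pivotal hε (M := {e}) rfl he
    have hge : g = e := hg
    rw [hge] at hgp
    exact h e rfl (pivotal_eq_false (hy.not_connects h0 r) hgp)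
  by_cases hlong : ∃ (g : Λ.Edge) (w : (nearGraph W).Walk e g), w.IsPath ∧ N ≤ w.length
  · obtain ⟨g, w, hw, hN⟩ := hlong
    have hw' := hw.take N
    have hlen : (w.take N).length = N := by simp [hN]
    generalize w.take N = v at hw' hlen
    have hsup : v.support = e :: v.support.tail := (v.cons_tail_support).symm
    refine ⟨v.support.tail, ?_, ?_, ?_, ?_⟩
    · rw [← hsup]
      exact (v.isChain_adj_support).imp fun a b h => h.2.1
    · rw [← hsup]
      exact hw'.support_nodup
    · simp [hlen]
    · rw [← hsup]
      intro f hf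
      refine ⟨mem_of_walk v heW f hf, fun x hx i => ?_⟩
      rw [abs_sub_comm]
      refine (abs_sub_le_of_walk (v.takeUntil f hf) x₀ hx₀ x hx i).trans ?_
      have := v.length_takeUntil_le_length hf
      rw [hlen] at this
      have : ((v.takeUntil f hf).length : ℤ) ≤ N := by exact_mod_cast this
      omega
  · exfalso
    push Not at hlong
    have hN : N ≠ 0 := by
      rintro rfl
      exact absurd (hlong e .nil (by simp)) (by simp)
    -- Every path from e now has length at most N - 1, so the component of e in W lies within
    -- distance 2(N-1)+1 = 2N-1 of `x₀`.
    set K : Set Λ.Edge := {f | (nearGraph W).Reachable e f} with hKdef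
    have hKW : K ⊆ W := by
      rintro f ⟨w⟩
      exact mem_of_walk w heW f w.end_mem_support
    have hKbox : ∀ f ∈ K, ∀ x ∈ f.1, ∀ i, |x.1 i - x₀.1 i| ≤ 2 * N - 1 := by
      rintro f hf x hx i
      obtain ⟨w, hw⟩ := SimpleGraph.Reachable.exists_isPath hf
      have h1 := hlong f w hw
      rw [abs_sub_comm]
      refine (abs_sub_le_of_walk w x₀ hx₀ x hx i).trans ?_
      omega
    set M : Set Λ.Edge := {g | ∃ f ∈ K, Near f g} with hM
    have heK : e ∈ K := SimpleGraph.Reachable.refl e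
    have hself : ∀ f : Λ.Edge, Near f f := by
      intro f
      obtain ⟨a, b, h, rfl⟩ := f.exists_eq_mkEdge
      exact ⟨a, by simp [mkEdge], a, by simp [mkEdge], by simp⟩
    have hMbox : ∀ f ∈ M, ∀ x ∈ f.1, ∀ i, |x.1 i - x₀.1 i| ≤ 2 * N + 1 := by
      rintro g ⟨f, hf, a, ha, b, hb, hab⟩ x hx i
      have h1 := abs_le.1 (Edge.abs_sub_le_one _ hx hb i)
      have h2 := abs_le.1 (hab i)
      have h3 := abs_le.1 (hKbox f hf a ha i)
      rw [abs_le]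
      omega
    have hMW : ∀ f ∈ M, f ∈ W → f ∈ K := by
      rintro g ⟨f, hf, hfg⟩ hg
      by_cases hfg' : f = g
      · rwa [← hfg']
      · exact SimpleGraph.Reachable.trans hf
          (SimpleGraph.Adj.reachable ⟨hfg', hfg, hKW hf, hg⟩)
    -- At the first time some edge g of the neighbourhood M of K is pivotal, a closed cut passes
    -- through g. Its edges in M are weakly closed, hence in K, so K isolates a nonempty piece of
    -- this cut.
    obtain ⟨r, -, g, hg, hgp, hgW⟩ :=
      hy.exists_first_pivotal hε (M := M) ⟨e, heK, hself e⟩ he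
    obtain ⟨c, hc, hgc⟩ := exists_cut_of_mem_pivotal (hy.not_connects h0 r) hgp
    refine hc.1.notMem_of_near_closed hd x₀.1 (2 * N - 1) (fun z hz => ?_) K hKbox ?_ g hgc
      (hMW g hg (hgW g hg (hc.2 g hgc)))
    · exact hbox hN z fun i => (hz i).trans (by omega)
    · intro f hf g hgc hfg
      have hgM : g ∈ M := ⟨f, hf, hfg⟩
      exact hMW g hgM (hgW g hgM (hc.2 g hgc))

end

end Box

/-! ### Effect of one edge on the number of clusters -/

/-- Adding one edge to a graph on a finite set decreases the number of components by at most one. -/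
lemma card_connectedComponent_le_add_one {V : Type*} [Finite V] {G G' : SimpleGraph V} (u v : V)
    (h : ∀ x y, G'.Adj x y → G.Adj x y ∨ (x = u ∧ y = v) ∨ (x = v ∧ y = u))
    (hle : G ≤ G') :
    Nat.card G.ConnectedComponent ≤ Nat.card G'.ConnectedComponent + 1 := by
  classical
  have hfin : ∀ H : SimpleGraph V, Finite H.ConnectedComponent := fun H => Quot.finite _
  have := hfin G
  have := hfin G'
  -- Merging the component of v into that of u gives a map constant on the components of G'. Hence
  -- the components of G other than that of v inject into those of G'.
  let r : V → G.ConnectedComponent := fun z =>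
    if G.connectedComponentMk z = G.connectedComponentMk v then G.connectedComponentMk u
    else G.connectedComponentMk z
  have hr : ∀ x y, G'.Reachable x y → r x = r y := by
    intro x y hxy
    refine hxy.mem_of_forall_adj (A := {z | r x = r z}) (fun a b hab ha => ?_) rfl
    have hab' : r a = r b := by
      rcases h a b hab with h1 | ⟨rfl, rfl⟩ | ⟨rfl, rfl⟩
      · have : G.connectedComponentMk a = G.connectedComponentMk b :=
          SimpleGraph.ConnectedComponent.sound h1.reachable
        simp only [r, this]
      · simp only [r]; split_ifs <;> rfl
      · simp only [r]; split_ifs <;> rfl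
    exact Eq.trans ha hab'
  let φ : G.ConnectedComponent → Option G'.ConnectedComponent := fun C =>
    if C = G.connectedComponentMk v then none
    else some (C.map (SimpleGraph.Hom.ofLE hle))
  have hφ : Function.Injective φ := by
    intro C C' hCC
    simp only [φ] at hCC
    split_ifs at hCC with h1 h2 h2
    · rw [h1, h2]
    · induction C using SimpleGraph.ConnectedComponent.ind with | _ x => ?_
      induction C' using SimpleGraph.ConnectedComponent.ind with | _ y => ?_
      have h3 : G'.Reachable x y := SimpleGraph.ConnectedComponent.exact (Option.some.inj hCC)
      have h4 := hr x y h3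
      simpa only [r, if_neg h1, if_neg h2] using h4
  have := Nat.card_le_card_of_injective φ hφ
  rwa [Finite.card_option] at this

namespace Box

variable {d : ℕ} {Λ : Box d}

open _root_.FK.Cube

/-! ### Weights -/

lemma openGraph_mono {ω ω' : Λ.Config} (h : ∀ f, ω f = true → ω' f = true) :
    openGraph ω ≤ openGraph ω' := by
  intro x y hxy
  obtain ⟨h1, h2⟩ := subgraphOf_adj.1 hxy
  exact subgraphOf_adj.2 ⟨h1, h _ h2⟩

lemma clusterCount_closeAt_le (ω : Λ.Config) (e : Λ.Edge) :
    clusterCount (closeAt ω e) ≤ clusterCount (openAt ω e) + 1 := by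
  obtain ⟨u, v, huv, rfl⟩ := e.exists_eq_mkEdge
  refine card_connectedComponent_le_add_one u v ?_ ?_
  · rintro x y (hxy | hxy)
    · obtain ⟨h1, h2⟩ := subgraphOf_adj.1 hxy
      by_cases he : mkEdge x y h1 = mkEdge u v huv
      · exact Or.inr (by simpa [mkEdge] using congrArg Subtype.val he)
      · refine Or.inl (Or.inl (subgraphOf_adj.2 ⟨h1, ?_⟩))
        change openAt ω _ _ = true at h2
        change closeAt ω _ _ = true
        rw [openAt_of_ne _ he] at h2
        rwa [closeAt_of_ne _ he]
    · exact Or.inl (Or.inr hxy)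
  · refine sup_le_sup_right (openGraph_mono fun f hf => ?_) _
    by_cases he : f = mkEdge u v huv
    · subst he; simp
    · rw [closeAt_of_ne _ he] at hf
      rwa [openAt_of_ne _ he]

lemma weight_pos {p q : ℝ} (hp0 : 0 < p) (hp1 : p < 1) (hq : 1 ≤ q) (ω : Λ.Config) :
    0 < weight p q ω := by
  refine mul_pos (Finset.prod_pos fun e _ => ?_) (pow_pos (by linarith) _)
  split_ifs <;> linarith

/-- The edge factor changes from p to 1-p, and closing creates at most one new cluster, which costs
at most q because q ≥ 1. -/
lemma weight_closeAt_le {p q : ℝ} (hp0 : 0 < p) (hp1 : p < 1) (hq : 1 ≤ q) (ω : Λ.Config)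
    (e : Λ.Edge) :
    weight p q (closeAt ω e) ≤ (1 - p) * q / p * weight p q (openAt ω e) := by
  classical
  set R : ℝ := ∏ f ∈ Finset.univ.erase e, if ω f = true then p else 1 - p with hR
  have hR0 : 0 ≤ R := Finset.prod_nonneg fun f _ => by split_ifs <;> linarith
  have h1 : weight p q (closeAt ω e) = (1 - p) * R * q ^ clusterCount (closeAt ω e) := by
    rw [weight, ← Finset.mul_prod_erase _ _ (Finset.mem_univ e), hR]
    congr 2
    · simp
    · refine Finset.prod_congr rfl fun f hf => ?_
      rw [closeAt_of_ne _ (Finset.ne_of_mem_erase hf)]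
  have h2 : weight p q (openAt ω e) = p * R * q ^ clusterCount (openAt ω e) := by
    rw [weight, ← Finset.mul_prod_erase _ _ (Finset.mem_univ e), hR]
    congr 2
    · simp
    · refine Finset.prod_congr rfl fun f hf => ?_
      rw [openAt_of_ne _ (Finset.ne_of_mem_erase hf)]
  rw [h1, h2]
  have h3 : q ^ clusterCount (closeAt ω e) ≤ q ^ clusterCount (openAt ω e) * q := by
    rw [← pow_succ]
    exact pow_le_pow_right₀ hq (clusterCount_closeAt_le ω e)
  calc (1 - p) * R * q ^ clusterCount (closeAt ω e)
      ≤ (1 - p) * R * (q ^ clusterCount (openAt ω e) * q) :=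
        mul_le_mul_of_nonneg_left h3 (mul_nonneg (by linarith) hR0)
    _ = (1 - p) * q / p * (p * R * q ^ clusterCount (openAt ω e)) := by
        field_simp

lemma closeProb_eq {p q : ℝ} (hp0 : 0 < p) (hp1 : p < 1) (hq : 1 ≤ q) (ω : Λ.Config)
    (e : Λ.Edge) : closeProb p q ω e =
      weight p q (closeAt ω e) / (weight p q (openAt ω e) + weight p q (closeAt ω e)) := by
  classical
  obtain ⟨Z, hZ, h⟩ : ∃ Z : ℝ, 0 < Z ∧ ∀ ω : Λ.Config, rcProb p q ω = weight p q ω / Z :=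
    ⟨_, Finset.sum_pos (fun ω _ => weight_pos hp0 hp1 hq ω) ⟨ω, Finset.mem_univ _⟩, fun _ => rfl⟩
  rw [closeProb, h, h, ← add_div, div_div_div_cancel_right₀ hZ.ne']

lemma closeProb_le {p q : ℝ} (hp0 : 0 < p) (hp1 : p < 1) (hq : 1 ≤ q) (ω : Λ.Config)
    (e : Λ.Edge) : closeProb p q ω e ≤ (1 - p) * q / p := by
  rw [closeProb_eq hp0 hp1 hq]
  have h1 := weight_pos (Λ := Λ) hp0 hp1 hq (openAt ω e)
  have h2 := weight_pos (Λ := Λ) hp0 hp1 hq (closeAt ω e)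
  rw [div_le_iff₀ (by positivity)]
  refine (weight_closeAt_le hp0 hp1 hq ω e).trans ?_
  refine mul_le_mul_of_nonneg_left (by linarith) ?_
  have : 0 ≤ 1 - p := by linarith
  positivity

lemma closeProb_pos {p q : ℝ} (hp0 : 0 < p) (hp1 : p < 1) (hq : 1 ≤ q) (ω : Λ.Config)
    (e : Λ.Edge) : 0 < closeProb p q ω e := by
  rw [closeProb_eq hp0 hp1 hq]
  have h1 := weight_pos (Λ := Λ) hp0 hp1 hq (openAt ω e)
  have h2 := weight_pos (Λ := Λ) hp0 hp1 hq (closeAt ω e)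
  positivity

lemma closeProb_lt_one {p q : ℝ} (hp0 : 0 < p) (hp1 : p < 1) (hq : 1 ≤ q) (ω : Λ.Config)
    (e : Λ.Edge) : closeProb p q ω e < 1 := by
  rw [closeProb_eq hp0 hp1 hq]
  have h1 := weight_pos (Λ := Λ) hp0 hp1 hq (openAt ω e)
  have h2 := weight_pos (Λ := Λ) hp0 hp1 hq (closeAt ω e)
  rw [div_lt_one (by positivity)]
  linarith

lemma openAt_openAt (ω : Λ.Config) (e : Λ.Edge) : openAt (openAt ω e) e = openAt ω e := by
  simp [openAt]

lemma closeAt_openAt (ω : Λ.Config) (e : Λ.Edge) : closeAt (openAt ω e) e = closeAt ω e := by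
  simp [openAt, closeAt]

lemma closeAt_eq_self {ω : Λ.Config} {e : Λ.Edge} (h : ω e = false) : closeAt ω e = ω := by
  rw [closeAt, ← h, Function.update_eq_self]

lemma openAt_ne_closeAt (ω : Λ.Config) (e : Λ.Edge) : openAt ω e ≠ closeAt ω e := by
  intro h
  have := congrFun h e
  simp at this

/-! ### Reversibility of the conditioned dynamics -/

/-- The unnormalised random-cluster measure conditioned on `T` and `B` not being connected. -/
noncomputable def disconnectedWeight (p q : ℝ) (ω : Λ.Config) : ℝ :=
  open Classical in if Connects ω then 0 else weight p q ω

/-- The probability that the process `Y` jumps from `ω` to `ω'` when the edge `e` is chosen. -/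
noncomputable def edgeTransition (p q : ℝ) (e : Λ.Edge) (ω ω' : Λ.Config) : ℝ :=
  (volume : Measure unitInterval).real {u | stepY p q ω e u = ω'}

lemma volume_unitInterval_ge {a : ℝ} (h0 : 0 ≤ a) (h1 : a ≤ 1) :
    (volume : Measure unitInterval).real {u | a ≤ (u : ℝ)} = 1 - a := by
  have : {u : unitInterval | a ≤ (u : ℝ)} = Set.Ici ⟨a, h0, h1⟩ := rfl
  rw [this, measureReal_def, unitInterval.volume_Ici]
  simp [h1]

lemma volume_unitInterval_lt {a : ℝ} (h0 : 0 ≤ a) (h1 : a ≤ 1) :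
    (volume : Measure unitInterval).real {u | (u : ℝ) < a} = a := by
  have : {u : unitInterval | (u : ℝ) < a} = Set.Iio ⟨a, h0, h1⟩ := rfl
  rw [this, measureReal_def, unitInterval.volume_Iio]
  simp [h0]

section

variable {p q : ℝ} (hp0 : 0 < p) (hp1 : p < 1) (hq : 1 ≤ q)

include hp0 hp1 hq in
-- If opening e connects T to B, both sides vanish: Y refuses the move, and the open configuration
-- has weight 0. Otherwise the threshold is the same in both configurations, and the opening and
-- closing probabilities are proportional to the two weights.
lemma edgeTransition_symm_aux (e : Λ.Edge) {ω : Λ.Config} (hω : ω e = false) :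
    disconnectedWeight p q ω * edgeTransition p q e ω (openAt ω e) =
      disconnectedWeight p q (openAt ω e) * edgeTransition p q e (openAt ω e) ω := by
  by_cases hc : Connects (openAt ω e)
  · have h1 : {u : unitInterval | stepY p q ω e u = openAt ω e} = ∅ := by
      ext u
      simp [stepY, hc, (openAt_ne_closeAt ω e).symm]
    simp [edgeTransition, h1, disconnectedWeight, hc]
  · have hcω : ¬ Connects ω := by
      have := not_connects_closeAt hc e
      rwa [closeAt_openAt, closeAt_eq_self hω] at this
    have hpos := (closeProb_pos hp0 hp1 hq ω e).le
    have hlt := (closeProb_lt_one hp0 hp1 hq ω e).le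
    have hcp : closeProb p q (openAt ω e) e = closeProb p q ω e := by
      rw [closeProb_eq hp0 hp1 hq, closeProb_eq hp0 hp1 hq, openAt_openAt, closeAt_openAt]
    have h1 : {u : unitInterval | stepY p q ω e u = openAt ω e} =
        {u : unitInterval | closeProb p q ω e ≤ (u : ℝ)} := by
      ext u
      by_cases hu : closeProb p q ω e ≤ (u : ℝ) <;>
        simp [stepY, hc, hu, (openAt_ne_closeAt ω e).symm]
    have h2 : {u : unitInterval | stepY p q (openAt ω e) e u = ω} =
        {u : unitInterval | (u : ℝ) < closeProb p q ω e} := by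
      have hne : openAt ω e ≠ ω := by
        have := openAt_ne_closeAt ω e
        rwa [closeAt_eq_self hω] at this
      ext u
      simp only [Set.mem_ofPred_eq, stepY, openAt_openAt, closeAt_openAt, hcp, hc,
        not_false_eq_true, and_true, closeAt_eq_self hω]
      split_ifs with hu
      · simp [hne, hu]
      · simpa using hu
    rw [edgeTransition, edgeTransition, h1, h2, volume_unitInterval_ge hpos hlt,
      volume_unitInterval_lt hpos hlt, disconnectedWeight, disconnectedWeight, if_neg hc,
      if_neg hcω, closeProb_eq hp0 hp1 hq, closeAt_eq_self hω]
    have h3 := weight_pos (Λ := Λ) hp0 hp1 hq (openAt ω e)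
    have h4 := weight_pos (Λ := Λ) hp0 hp1 hq ω
    field_simp
    ring

include hp0 hp1 hq in
/-- Detailed balance for the process `Y`. -/
lemma edgeTransition_symm (e : Λ.Edge) (ω ω' : Λ.Config) :
    disconnectedWeight p q ω * edgeTransition p q e ω ω' =
      disconnectedWeight p q ω' * edgeTransition p q e ω' ω := by
  by_cases heq : ω = ω'
  · rw [heq]
  by_cases hoff : ∀ f, f ≠ e → ω f = ω' f
  · cases h : ω e
    · have h' : ω' = openAt ω e := by
        funext f
        by_cases hf : f = e
        · subst hf
          rw [openAt_self]
          by_contra hc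
          refine heq (funext fun g => ?_)
          by_cases hg : g = f
          · subst hg; simp [h, Bool.eq_false_iff.2 hc]
          · exact hoff g hg
        · rw [openAt_of_ne _ hf, hoff f hf]
      rw [h']
      exact edgeTransition_symm_aux hp0 hp1 hq e h
    · have h0 : ω' e = false := by
        by_contra hc
        refine heq (funext fun g => ?_)
        by_cases hg : g = e
        · subst hg; simpa [h] using hc
        · exact hoff g hg
      have h' : ω = openAt ω' e := by
        funext f
        by_cases hf : f = e
        · subst hf
          rw [openAt_self, h]
        · rw [openAt_of_ne _ hf, hoff f hf]
      rw [h']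
      exact (edgeTransition_symm_aux hp0 hp1 hq e h0).symm
  · push Not at hoff
    obtain ⟨f, hf, hne⟩ := hoff
    have hz : ∀ ω ω' : Λ.Config, ω f ≠ ω' f → edgeTransition p q e ω ω' = 0 := by
      intro ω ω' h
      have : {u : unitInterval | stepY p q ω e u = ω'} = ∅ := by
        ext u
        simp only [Set.mem_ofPred_eq, Set.mem_empty_iff_false, iff_false]
        intro hu
        apply h
        rw [← hu, stepY]
        split_ifs
        · rw [openAt_of_ne _ hf]
        · rw [closeAt_of_ne _ hf]
      simp [edgeTransition, this]
    rw [hz _ _ hne, hz _ _ hne.symm, mul_zero, mul_zero]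

lemma measurable_stepY (ω : Λ.Config) (e : Λ.Edge) :
    Measurable fun u : unitInterval => stepY p q ω e u := by
  classical
  have h : MeasurableSet {u : unitInterval | closeProb p q ω e ≤ u ∧ ¬ Connects (openAt ω e)} :=
    (measurableSet_le measurable_const measurable_subtype_coe).inter (.const _)
  exact (measurable_const (a := openAt ω e)).ite h (measurable_const (a := closeAt ω e))

open Classical in
lemma sum_edgeTransition (e : Λ.Edge) (ω : Λ.Config) :
    ∑ ω' : Λ.Config, edgeTransition p q e ω ω' = 1 := by
  have h := measureReal_biUnion_finset (μ := (volume : Measure unitInterval))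
    (s := (Finset.univ : Finset Λ.Config)) (f := fun ω' => {u | stepY p q ω e u = ω'})
    (fun a _ b _ hab => Set.disjoint_left.2 fun u hu hu' => hab (hu.symm.trans hu'))
    (fun ω' _ => measurable_stepY ω e (measurableSet_singleton ω'))
  simp only [edgeTransition]
  rw [← h]
  have : (⋃ b ∈ (Finset.univ : Finset Λ.Config), {u : unitInterval | stepY p q ω e u = b}) =
      Set.univ := by
    ext u; simp
  rw [this]
  simp

include hp0 hp1 hq in
-- Closing is never refused. Every configuration thus leads to the all-closed one, which is all the
-- irreducibility that the maximum principle needs.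
lemma edgeTransition_closeAt_pos (e : Λ.Edge) (ω : Λ.Config) :
    0 < edgeTransition p q e ω (closeAt ω e) := by
  have h : {u : unitInterval | (u : ℝ) < closeProb p q ω e} ⊆
      {u | stepY p q ω e u = closeAt ω e} := by
    intro u hu
    have hu' : (u : ℝ) < closeProb p q ω e := hu
    simp [stepY, not_le.2 hu']
  refine lt_of_lt_of_le ?_ (measureReal_mono h)
  rw [volume_unitInterval_lt (closeProb_pos hp0 hp1 hq ω e).le
    (closeProb_lt_one hp0 hp1 hq ω e).le]
  exact closeProb_pos hp0 hp1 hq ω e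

lemma edgeTransition_eq_zero (e : Λ.Edge) {ω ω' : Λ.Config} (h : ¬ Connects ω)
    (h' : Connects ω') : edgeTransition p q e ω ω' = 0 := by
  have : {u : unitInterval | stepY p q ω e u = ω'} = ∅ := by
    ext u
    simp only [Set.mem_ofPred_eq, Set.mem_empty_iff_false, iff_false]
    intro hu
    exact not_connects_stepY h e u (hu ▸ h')
  simp [edgeTransition, this]

end

/-! ### The equilibrium distribution of `Y` -/

instance [Nonempty Λ.Edge] : IsProbabilityMeasure Λ.noiseLaw := by
  have : IsProbabilityMeasure (uniformOn (Set.univ : Set Λ.Edge)) :=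
    isProbabilityMeasure_uniformOn Set.finite_univ Set.univ_nonempty
  unfold noiseLaw
  infer_instance

lemma noiseLaw_real_singleton_prod [Nonempty Λ.Edge] (e : Λ.Edge) (S : Set unitInterval) :
    Λ.noiseLaw.real ({e} ×ˢ S) =
      (Fintype.card Λ.Edge : ℝ)⁻¹ * (volume : Measure unitInterval).real S := by
  rw [noiseLaw, measureReal_prod_prod]
  congr 1
  rw [measureReal_def, uniformOn_univ]
  simp

/-- The transition probabilities of `Y`. -/
noncomputable def transition (p q : ℝ) (ω ω' : Λ.Config) : ℝ :=
  (Fintype.card Λ.Edge : ℝ)⁻¹ * ∑ e, edgeTransition p q e ω ω'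

lemma noiseLaw_real_stepY [Nonempty Λ.Edge] (p q : ℝ) (ω ω' : Λ.Config) :
    Λ.noiseLaw.real {n | stepY p q ω n.1 n.2 = ω'} = transition p q ω ω' := by
  classical
  have h : {n : Λ.Noise | stepY p q ω n.1 n.2 = ω'} =
      ⋃ e ∈ (Finset.univ : Finset Λ.Edge),
        ({e} : Set Λ.Edge) ×ˢ {u : unitInterval | stepY p q ω e u = ω'} := by
    ext ⟨e, u⟩
    simp only [Set.mem_iUnion, Set.mem_prod, Set.mem_singleton_iff, Set.mem_ofPred_eq,
      Finset.mem_univ, exists_true_left]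
    exact ⟨fun h => ⟨e, rfl, h⟩, fun ⟨e', h1, h2⟩ => by rw [h1]; exact h2⟩
  rw [h, measureReal_biUnion_finset, transition, Finset.mul_sum]
  · exact Finset.sum_congr rfl fun e _ => noiseLaw_real_singleton_prod e _
  · intro a _ b _ hab
    refine Set.disjoint_left.2 ?_
    rintro ⟨e, u⟩ ⟨h1, -⟩ ⟨h2, -⟩
    exact hab (h1.symm.trans h2)
  · intro e _
    exact (MeasurableSet.singleton e).prod (measurable_stepY ω e (measurableSet_singleton ω'))

/-- The law of the process `Y` at equilibrium. -/
noncomputable def marginal (μ : Measure Λ.State) (ω : Λ.Config) : ℝ := μ.real {z | z.2 = ω}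

-- Y evolves without looking at X, so the second marginal of an invariant law of the pair is
-- invariant for the kernel of Y alone.
open Classical in
lemma IsEquilibrium.marginal_eq_sum [Nonempty Λ.Edge] {p q : ℝ} {μ : Measure Λ.State}
    (hμ : Λ.IsEquilibrium p q μ) (ω' : Λ.Config) :
    marginal μ ω' = ∑ ω, marginal μ ω * transition p q ω ω' := by
  have := hμ.isProbabilityMeasure
  have hm : MeasurableSet {z : Λ.State | z.2 = ω'} := Set.Finite.measurableSet (Set.toFinite _)
  have h : (fun a : Λ.State × Λ.Noise => step p q a.1 a.2) ⁻¹' {z | z.2 = ω'} =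
      ⋃ ω ∈ (Finset.univ : Finset Λ.Config),
        {z : Λ.State | z.2 = ω} ×ˢ {n : Λ.Noise | stepY p q ω n.1 n.2 = ω'} := by
    ext ⟨z, n⟩
    simp [step]
  have hmn : ∀ ω, MeasurableSet {n : Λ.Noise | stepY p q ω n.1 n.2 = ω'} := by
    intro ω
    exact measurable_from_prod_countable_right (fun e => measurable_stepY ω e)
      (measurableSet_singleton ω')
  conv_lhs => rw [marginal, ← hμ.invariant]
  rw [map_measureReal_apply (measurable_step p q) hm, h, measureReal_biUnion_finset]
  · refine Finset.sum_congr rfl fun ω _ => ?_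
    rw [measureReal_prod_prod, noiseLaw_real_stepY, marginal]
  · intro a _ b _ hab
    refine Set.disjoint_left.2 ?_
    rintro ⟨z, n⟩ ⟨h1, -⟩ ⟨h2, -⟩
    exact hab (h1.symm.trans h2)
  · exact fun ω _ => (Set.Finite.measurableSet (Set.toFinite _)).prod (hmn ω)

lemma IsEquilibrium.marginal_eq_zero {p q : ℝ} {μ : Measure Λ.State}
    (hμ : Λ.IsEquilibrium p q μ) {ω : Λ.Config} (h : Connects ω) : marginal μ ω = 0 := by
  have := hμ.isProbabilityMeasure
  have hs : MeasurableSet Λ.stateSpace := Set.Finite.measurableSet (Set.toFinite _)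
  have h1 : μ Λ.stateSpaceᶜ = 0 := by
    rw [prob_compl_eq_zero_iff hs]
    exact hμ.stateSpace_eq_one
  rw [marginal, measureReal_def, measure_mono_null _ h1, ENNReal.toReal_zero]
  rintro z hz hzs
  exact hzs.1 (hz ▸ h)

section

variable {p q : ℝ} (hp0 : 0 < p) (hp1 : p < 1) (hq : 1 ≤ q)

lemma transition_nonneg (ω ω' : Λ.Config) : 0 ≤ transition p q ω ω' :=
  mul_nonneg (by positivity) (Finset.sum_nonneg fun _ _ => measureReal_nonneg)

include hp0 hp1 hq in
lemma transition_symm (ω ω' : Λ.Config) :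
    disconnectedWeight p q ω * transition p q ω ω' =
      disconnectedWeight p q ω' * transition p q ω' ω := by
  rw [transition, transition, mul_left_comm, mul_left_comm (disconnectedWeight p q ω')]
  congr 1
  rw [Finset.mul_sum, Finset.mul_sum]
  exact Finset.sum_congr rfl fun e _ => edgeTransition_symm hp0 hp1 hq e ω ω'

open Classical in
lemma sum_transition [Nonempty Λ.Edge] (ω : Λ.Config) :
    ∑ ω' : Λ.Config, transition p q ω ω' = 1 := by
  simp only [transition]
  rw [← Finset.mul_sum, Finset.sum_comm]
  simp only [sum_edgeTransition, Finset.sum_const, Finset.card_univ, nsmul_eq_mul, mul_one]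
  exact inv_mul_cancel₀ (Nat.cast_ne_zero.2 Fintype.card_ne_zero)

include hp0 hp1 hq in
lemma transition_closeAt_pos [Nonempty Λ.Edge] (ω : Λ.Config) (e : Λ.Edge) :
    0 < transition p q ω (closeAt ω e) := by
  refine mul_pos (inv_pos.2 (Nat.cast_pos.2 Fintype.card_pos)) ?_
  refine Finset.sum_pos' (fun _ _ => measureReal_nonneg) ⟨e, Finset.mem_univ e, ?_⟩
  exact edgeTransition_closeAt_pos hp0 hp1 hq e ω

lemma transition_eq_zero {ω ω' : Λ.Config} (h : ¬ Connects ω) (h' : Connects ω') :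
    transition p q ω ω' = 0 := by
  rw [transition, Finset.sum_eq_zero fun e _ => edgeTransition_eq_zero e h h', mul_zero]

include hp0 hp1 hq in
open Classical in
/-- Maximum principle for the harmonic functions of the process `Y`. -/
lemma harmonic_le [Nonempty Λ.Edge] (g : Λ.Config → ℝ)
    (hg : ∀ ω, ¬ Connects ω → ∑ ω' : Λ.Config, transition p q ω ω' * g ω' = g ω)
    {ω : Λ.Config} (hω : ¬ Connects ω) : g ω ≤ g fun _ => false := by
  obtain ⟨ω₁, h1, hmax⟩ := Finset.exists_max_image
    (Finset.univ.filter fun ω : Λ.Config => ¬ Connects ω) g ⟨ω, by simpa using hω⟩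
  simp only [Finset.mem_filter, Finset.mem_univ, true_and] at h1 hmax
  -- At a maximum the nonnegative terms p(η,ω')(max - g(ω')) sum to 0, so g is also maximal at every
  -- configuration reachable in one step. Closing the edges one by one carries the maximum to the
  -- all-closed configuration.
  have hclose : ∀ η : Λ.Config, ¬ Connects η → g η = g ω₁ → ∀ e, g (closeAt η e) = g ω₁ := by
    intro η hη hgη e
    have hsum : ∑ ω' : Λ.Config, transition p q η ω' * (g ω₁ - g ω') = 0 := by
      simp only [mul_sub]
      rw [Finset.sum_sub_distrib, ← Finset.sum_mul, sum_transition, hg η hη, hgη]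
      ring
    have hnn : ∀ ω' ∈ (Finset.univ : Finset Λ.Config),
        0 ≤ transition p q η ω' * (g ω₁ - g ω') := by
      intro ω' _
      by_cases hc : Connects ω'
      · rw [transition_eq_zero hη hc, zero_mul]
      · exact mul_nonneg (transition_nonneg _ _) (sub_nonneg.2 (hmax _ hc))
    have h0 := (Finset.sum_eq_zero_iff_of_nonneg hnn).1 hsum (closeAt η e) (Finset.mem_univ _)
    rcases mul_eq_zero.1 h0 with h | h
    · exact absurd h (transition_closeAt_pos hp0 hp1 hq η e).ne'
    · linarith
  have hind : ∀ S : Finset Λ.Edge, ¬ Connects (fun e => if e ∈ S then false else ω₁ e) ∧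
      g (fun e => if e ∈ S then false else ω₁ e) = g ω₁ := by
    intro S
    induction S using Finset.induction_on with
    | empty => simpa using h1
    | insert a S ha ih =>
      have : (fun e => if e ∈ insert a S then false else ω₁ e) =
          closeAt (fun e => if e ∈ S then false else ω₁ e) a := by
        funext f
        by_cases hf : f = a
        · subst hf; simp
        · rw [closeAt_of_ne _ hf]; simp [hf]
      rw [this]
      exact ⟨not_connects_closeAt ih.1 a, hclose _ ih.1 ih.2 a⟩
  have := (hind Finset.univ).2
  simp only [Finset.mem_univ, if_true] at this
  rw [this]
  exact hmax ω hω

include hp0 hp1 hq in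
/-- At equilibrium, `Y` has the law of the random-cluster measure conditioned on `T` and `B` not
being connected. -/
theorem IsEquilibrium.marginal_eq [Nonempty Λ.Edge] {μ : Measure Λ.State}
    (hμ : Λ.IsEquilibrium p q μ) :
    ∃ κ : ℝ, 0 ≤ κ ∧ ∀ ω, marginal μ ω = κ * disconnectedWeight p q ω := by
  classical
  have hw := weight_pos (Λ := Λ) hp0 hp1 hq
  -- By reversibility the density of an invariant law is harmonic. The maximum principle for h and
  -- -h makes it constant on disconnected configurations.
  let h : Λ.Config → ℝ := fun ω => marginal μ ω / weight p q ω
  have hh : ∀ ω, marginal μ ω = h ω * disconnectedWeight p q ω := by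
    intro ω
    by_cases hc : Connects ω
    · simp [disconnectedWeight, hc, hμ.marginal_eq_zero hc]
    · simp only [h, disconnectedWeight, if_neg hc]
      rw [div_mul_cancel₀ _ (hw ω).ne']
  have hharm : ∀ ω, ¬ Connects ω → ∑ ω' : Λ.Config, transition p q ω ω' * h ω' = h ω := by
    intro ω hω
    have h1 : disconnectedWeight p q ω ≠ 0 := by
      rw [disconnectedWeight, if_neg hω]
      exact (hw ω).ne'
    apply mul_left_cancel₀ h1
    rw [mul_comm _ (h ω), ← hh, hμ.marginal_eq_sum, Finset.mul_sum]
    refine Finset.sum_congr rfl fun ω' _ => ?_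
    rw [← mul_assoc, transition_symm hp0 hp1 hq, hh ω']
    ring
  refine ⟨h fun _ => false, div_nonneg measureReal_nonneg (hw _).le, fun ω => ?_⟩
  by_cases hc : Connects ω
  · simp [disconnectedWeight, hc, hμ.marginal_eq_zero hc]
  · have h1 := harmonic_le hp0 hp1 hq h hharm hc
    have h2 := harmonic_le hp0 hp1 hq (fun ω => -h ω)
      (fun ω hω => by simp [hharm ω hω]) hc
    rw [hh ω, le_antisymm h1 (neg_le_neg_iff.1 h2)]

include hp0 hp1 hq in
open Classical in
/-- Finite energy: conditionally on an event stable under the opening of the edges of `R`, the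
edges of a subset of `R` are all closed with exponentially small probability. -/
theorem IsEquilibrium.sum_marginal_closed_le [Nonempty Λ.Edge] {μ : Measure Λ.State}
    (hμ : Λ.IsEquilibrium p q μ) (D : Set Λ.Config) (hD : ∀ ω ∈ D, ¬ Connects ω)
    (R : Set Λ.Edge) (hR : ∀ ω ∈ D, ∀ f ∈ R, openAt ω f ∈ D) (S : Finset Λ.Edge)
    (hS : ∀ f ∈ S, f ∈ R) :
    ∑ ω : Λ.Config with ω ∈ D ∧ ∀ f ∈ S, ω f = false, marginal μ ω ≤
      ((1 - p) * q / p) ^ S.card * ∑ ω : Λ.Config with ω ∈ D, marginal μ ω := by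
  obtain ⟨κ, hκ, hm⟩ := hμ.marginal_eq hp0 hp1 hq
  have hε : 0 ≤ (1 - p) * q / p := by
    have : 0 ≤ 1 - p := by linarith
    positivity
  have hflip : ∀ ω ∈ D, ∀ f ∈ R, ω f = false →
      marginal μ ω ≤ (1 - p) * q / p * marginal μ (openAt ω f) := by
    intro ω hω f hf hc
    rw [hm, hm, disconnectedWeight, disconnectedWeight, if_neg (hD ω hω),
      if_neg (hD _ (hR ω hω f hf)), mul_left_comm]
    refine mul_le_mul_of_nonneg_left ?_ hκ
    have := weight_closeAt_le hp0 hp1 hq ω f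
    rwa [closeAt_eq_self hc] at this
  induction S using Finset.induction_on with
  | empty => simp
  | insert a S ha ih =>
    have ih' := ih fun f hf => hS f (Finset.mem_insert_of_mem hf)
    have haR := hS a (Finset.mem_insert_self a S)
    rw [Finset.card_insert_of_notMem ha, pow_succ', mul_assoc]
    refine le_trans ?_ (mul_le_mul_of_nonneg_left ih' hε)
    rw [Finset.mul_sum]
    -- Opening a is injective on configurations where a is closed, keeps them in D, and divides
    -- their probability by at most ε; this removes a from the set at the cost of one factor.
    have hinj : Set.InjOn (fun ω : Λ.Config => openAt ω a)
        (Finset.univ.filter fun ω : Λ.Config => ω ∈ D ∧ ∀ f ∈ insert a S, ω f = false) := by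
      intro ω hω ω' hω' h
      simp only [Finset.coe_filter, Finset.mem_univ, true_and, Set.mem_ofPred_eq,
        Finset.mem_insert, forall_eq_or_imp] at hω hω'
      have h' : openAt ω a = openAt ω' a := h
      rw [← closeAt_eq_self hω.2.1, ← closeAt_eq_self hω'.2.1, ← closeAt_openAt, h',
        closeAt_openAt]
    refine le_trans (Finset.sum_le_sum (g := fun ω : Λ.Config =>
      (1 - p) * q / p * marginal μ (openAt ω a)) fun ω hω => ?_) ?_
    · simp only [Finset.mem_filter, Finset.mem_univ, true_and, Finset.mem_insert,
        forall_eq_or_imp] at hω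
      exact hflip ω hω.1 a haR hω.2.1
    · rw [← Finset.sum_image (f := fun ω => (1 - p) * q / p * marginal μ ω) hinj]
      refine Finset.sum_le_sum_of_subset_of_nonneg ?_ fun ω _ _ =>
        mul_nonneg hε measureReal_nonneg
      intro ω' hω'
      simp only [Finset.mem_image, Finset.mem_filter, Finset.mem_univ, true_and,
        Finset.mem_insert, forall_eq_or_imp] at hω' ⊢
      obtain ⟨ω, ⟨h1, -, h3⟩, rfl⟩ := hω'
      refine ⟨hR ω h1 a haR, fun f hf => ?_⟩
      rw [openAt_of_ne _ (by rintro rfl; exact ha hf)]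
      exact h3 f hf

end

/-! ### The noise after a given time is independent of the state -/

/-- The joint law of the initial state and of the noise. -/
noncomputable abbrev drivingLaw (μ : Measure Λ.State) : Measure (Λ.State × (ℕ → Λ.Noise)) :=
  μ.prod (Measure.infinitePi fun _ : ℕ => Λ.noiseLaw)

lemma measurable_trajectory_apply (p q : ℝ) (t : ℕ) :
    Measurable fun a : Λ.State × (ℕ → Λ.Noise) => trajectory p q a t :=
  (measurable_pi_apply t).comp (measurable_trajectory p q)

lemma measurable_step_left (p q : ℝ) (z : Λ.State) :
    Measurable fun n : Λ.Noise => step p q z n := by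
  have h : Measurable fun n : Λ.Noise => (z, n) := measurable_prodMk_left
  have h2 := (measurable_step (Λ := Λ) p q).comp h
  simp only [Function.comp_def] at h2
  exact h2

/-- At equilibrium, the state at time `t` has law `μ` and is independent of the later noise. -/
theorem IsEquilibrium.trajectory_noise [Nonempty Λ.Edge] {p q : ℝ} {μ : Measure Λ.State}
    (hμ : Λ.IsEquilibrium p q μ) (t : ℕ) :
    ∀ (D : Set Λ.State) (I : Finset ℕ) (C : ℕ → Set Λ.Noise), (∀ i ∈ I, t < i) →
      (∀ i, MeasurableSet (C i)) →
      (drivingLaw μ).real {a | trajectory p q a t ∈ D ∧ ∀ i ∈ I, a.2 i ∈ C i} =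
        μ.real D * ∏ i ∈ I, Λ.noiseLaw.real (C i) := by
  classical
  have := hμ.isProbabilityMeasure
  induction t with
  | zero =>
    intro D I C _ hC
    have h : {a : Λ.State × (ℕ → Λ.Noise) | trajectory p q a 0 ∈ D ∧ ∀ i ∈ I, a.2 i ∈ C i} =
        D ×ˢ (Set.pi I C) := by
      ext a
      simp [trajectory, Set.mem_pi]
    rw [h, measureReal_prod_prod]
    congr 1
    rw [measureReal_def, Measure.infinitePi_pi _ fun i _ => hC i, ENNReal.toReal_prod]
    rfl
  | succ t ih =>
    intro D I C hI hC
    have hDm : MeasurableSet D := Set.Finite.measurableSet (Set.toFinite _)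
    have hm : ∀ z, MeasurableSet {n : Λ.Noise | step p q z n ∈ D} := fun z =>
      measurable_step_left p q z hDm
    have ht : t + 1 ∉ I := fun h => lt_irrefl _ (hI _ h)
    -- Once the state z at time t is fixed, the event at time t+1 becomes a constraint on the noise
    -- coordinate t+1 alone. Summing over z recovers μ by invariance.
    let C' : Λ.State → ℕ → Set Λ.Noise := fun z =>
      Function.update C (t + 1) {n | step p q z n ∈ D}
    have hC' : ∀ z i, MeasurableSet (C' z i) := by
      intro z i
      by_cases hi : i = t + 1
      · subst hi; simpa [C'] using hm z
      · simpa [C', hi] using hC i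
    have hsplit : {a : Λ.State × (ℕ → Λ.Noise) |
        trajectory p q a (t + 1) ∈ D ∧ ∀ i ∈ I, a.2 i ∈ C i} =
        ⋃ z ∈ (Finset.univ : Finset Λ.State), {a | trajectory p q a t ∈ ({z} : Set Λ.State) ∧
          ∀ i ∈ insert (t + 1) I, a.2 i ∈ C' z i} := by
      ext a
      have hcongr : ∀ z, (∀ i ∈ I, a.2 i ∈ C' z i) ↔ ∀ i ∈ I, a.2 i ∈ C i := by
        intro z
        refine forall₂_congr fun i hi => ?_
        have : i ≠ t + 1 := by rintro rfl; exact ht hi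
        simp [C', this]
      simp only [Set.mem_ofPred_eq, trajectory, Set.mem_iUnion, Finset.mem_univ, exists_true_left,
        Set.mem_singleton_iff, Finset.forall_mem_insert, hcongr, exists_eq_left']
      simp [C']
    rw [hsplit, measureReal_biUnion_finset]
    · have h1 : ∀ z ∈ (Finset.univ : Finset Λ.State),
          (drivingLaw μ).real {a | trajectory p q a t ∈ ({z} : Set Λ.State) ∧
            ∀ i ∈ insert (t + 1) I, a.2 i ∈ C' z i} =
          (μ.prod Λ.noiseLaw).real ({z} ×ˢ {n | step p q z n ∈ D}) *
            ∏ i ∈ I, Λ.noiseLaw.real (C i) := by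
        intro z _
        rw [ih _ _ _ (fun i hi => ?_) (hC' z), Finset.prod_insert ht, measureReal_prod_prod,
          ← mul_assoc]
        · congr 1
          · simp [C']
          · refine Finset.prod_congr rfl fun i hi => ?_
            have : i ≠ t + 1 := by rintro rfl; exact ht hi
            simp [C', this]
        · rcases Finset.mem_insert.1 hi with rfl | hi
          · exact Nat.lt_succ_self t
          · exact (Nat.lt_succ_self t).trans (hI i hi)
      rw [Finset.sum_congr rfl h1, ← Finset.sum_mul]
      congr 1
      rw [← measureReal_biUnion_finset]
      · conv_rhs => rw [← hμ.invariant, map_measureReal_apply (measurable_step p q) hDm]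
        congr 1
        ext ⟨z, n⟩
        simp
      · intro a _ b _ hab
        refine Set.disjoint_left.2 ?_
        rintro ⟨z, n⟩ ⟨h1, -⟩ ⟨h2, -⟩
        exact hab (h1.symm.trans h2)
      · exact fun z _ => (measurableSet_singleton z).prod (hm z)
    · intro z _ z' _ hz
      refine Set.disjoint_left.2 ?_
      rintro a ⟨h1, -⟩ ⟨h2, -⟩
      exact hz (h1.symm.trans h2)
    · intro z _
      refine (measurable_trajectory_apply p q t (measurableSet_singleton z)).inter ?_
      have : {a : Λ.State × (ℕ → Λ.Noise) | ∀ i ∈ insert (t + 1) I, a.2 i ∈ C' z i} =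
          ⋂ i ∈ insert (t + 1) I, (fun a : Λ.State × (ℕ → Λ.Noise) => a.2 i) ⁻¹' C' z i := by
        ext a; simp
      change MeasurableSet {a : Λ.State × (ℕ → Λ.Noise) | ∀ i ∈ insert (t + 1) I, a.2 i ∈ C' z i}
      rw [this]
      exact Finset.measurableSet_biInter _ fun i _ =>
        ((measurable_pi_apply i).comp measurable_snd) (hC' z i)

open Classical in
lemma sum_marginal {μ : Measure Λ.State} [IsProbabilityMeasure μ] (P : Λ.Config → Prop)
    [DecidablePred P] :
    μ.real {z | P z.2} = ∑ ω with P ω, marginal μ ω := by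
  have h : {z : Λ.State | P z.2} = ⋃ ω ∈ Finset.univ.filter P, {z : Λ.State | z.2 = ω} := by
    ext z; simp
  rw [h, measureReal_biUnion_finset]
  · rfl
  · intro a _ b _ hab
    exact Set.disjoint_left.2 fun z h1 h2 => hab (h1.symm.trans h2)
  · exact fun ω _ => Set.Finite.measurableSet (Set.toFinite _)

/-! ### Union bound over the causes of weak closure -/

/-- The noises which close the edge `e` weakly. -/
def smallNoise (ε : ℝ) (e : Λ.Edge) : Set Λ.Noise := {e} ×ˢ {u : unitInterval | (u : ℝ) < ε}

lemma measurableSet_smallNoise (ε : ℝ) (e : Λ.Edge) : MeasurableSet (smallNoise ε e) :=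
  (MeasurableSet.singleton e).prod (measurableSet_lt measurable_subtype_coe measurable_const)

lemma noiseLaw_smallNoise [Nonempty Λ.Edge] {ε : ℝ} (h0 : 0 ≤ ε) (h1 : ε ≤ 1) (e : Λ.Edge) :
    Λ.noiseLaw.real (smallNoise ε e) = ε / Fintype.card Λ.Edge := by
  rw [smallNoise, noiseLaw_real_singleton_prod, volume_unitInterval_lt h0 h1, mul_comm,
    div_eq_mul_inv]

/-- Probability that the edges of a set are weakly closed between the times `t` and `t + s`,
jointly with an event on `Y_t` which is stable under the opening of these edges. -/
theorem IsEquilibrium.weaklyClosed_le [Nonempty Λ.Edge] {p q : ℝ} (hp0 : 0 < p) (hp1 : p < 1)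
    (hq : 1 ≤ q) {ε : ℝ} (hε : ε = (1 - p) * q / p) (hε1 : ε ≤ 1) {μ : Measure Λ.State}
    (hμ : Λ.IsEquilibrium p q μ) (D : Set Λ.Config) (hD : ∀ ω ∈ D, ¬ Connects ω)
    (R : Set Λ.Edge) (hR : ∀ ω ∈ D, ∀ f ∈ R, openAt ω f ∈ D) (t s : ℕ) (S : Finset Λ.Edge)
    (hS : ∀ f ∈ S, f ∈ R) :
    (drivingLaw μ).real {a | (trajectory p q a t).2 ∈ D ∧
        ∀ f ∈ S, f ∈ weaklyClosed ε s (trajectory p q a t).2 fun k => a.2 (t + k)} ≤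
      (ε * (1 + s / Fintype.card Λ.Edge)) ^ S.card * μ.real {z | z.2 ∈ D} := by
  classical
  have := hμ.isProbabilityMeasure
  have hε0 : 0 ≤ ε := by
    have : 0 ≤ 1 - p := by linarith
    rw [hε]
    positivity
  set E : ℝ := (Fintype.card Λ.Edge : ℝ) with hE
  have hE0 : 0 < E := Nat.cast_pos.2 Fintype.card_pos
  -- The causes are assigned one edge at a time: `S₀` collects edges declared closed at time t, and
  -- I the times declared to hit the edges `g i` weakly. Treating one more edge costs ε for the
  -- first cause and at most s·ε/E for the second.
  have key : ∀ S : Finset Λ.Edge, (∀ f ∈ S, f ∈ R) → ∀ (S₀ : Finset Λ.Edge) (I : Finset ℕ)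
      (g : ℕ → Λ.Edge), (∀ f ∈ S₀, f ∈ R) → Disjoint S S₀ → (∀ i ∈ I, t < i ∧ g i ∉ S) →
      (drivingLaw μ).real {a | (trajectory p q a t).2 ∈ D ∧
        (∀ f ∈ S₀, (trajectory p q a t).2 f = false) ∧ (∀ i ∈ I, a.2 i ∈ smallNoise ε (g i)) ∧
        ∀ f ∈ S, f ∈ weaklyClosed ε s (trajectory p q a t).2 fun k => a.2 (t + k)} ≤
      (ε * (1 + s / E)) ^ S.card * (ε ^ S₀.card * (ε / E) ^ I.card * μ.real {z | z.2 ∈ D}) := by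
    intro S
    induction S using Finset.induction_on with
    | empty =>
      intro _ S₀ I g hS₀ _ hI
      have h := hμ.trajectory_noise t {z | z.2 ∈ D ∧ ∀ f ∈ S₀, z.2 f = false} I
        (fun i => smallNoise ε (g i)) (fun i hi => (hI i hi).1)
        (fun i => measurableSet_smallNoise _ _)
      have h2 := hμ.sum_marginal_closed_le hp0 hp1 hq D hD R hR S₀ hS₀
      rw [← sum_marginal, ← sum_marginal, ← hε] at h2
      simp only [noiseLaw_smallNoise hε0 hε1, Finset.prod_const] at h
      simp only [Finset.card_empty, pow_zero, one_mul, Finset.notMem_empty, false_imp_iff,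
        implies_true, and_true]
      have h3 : {a : Λ.State × (ℕ → Λ.Noise) | (trajectory p q a t).2 ∈ D ∧
          (∀ f ∈ S₀, (trajectory p q a t).2 f = false) ∧ ∀ i ∈ I, a.2 i ∈ smallNoise ε (g i)} =
          {a | trajectory p q a t ∈ {z : Λ.State | z.2 ∈ D ∧ ∀ f ∈ S₀, z.2 f = false} ∧
            ∀ i ∈ I, a.2 i ∈ smallNoise ε (g i)} := by
        ext a; simp only [Set.mem_ofPred_eq, and_assoc]
      rw [h3, h, mul_right_comm]
      exact mul_le_mul_of_nonneg_right h2 (by positivity)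
    | insert f S hf ih =>
      intro hSR S₀ I g hS₀ hdisj hI
      have ih' := ih fun f hf => hSR f (Finset.mem_insert_of_mem hf)
      have hfR := hSR f (Finset.mem_insert_self f S)
      rw [Finset.disjoint_insert_left] at hdisj
      have hI' : ∀ i ∈ I, t < i ∧ g i ∉ S := fun i hi =>
        ⟨(hI i hi).1, fun h => (hI i hi).2 (Finset.mem_insert_of_mem h)⟩
      set A : Finset Λ.Edge → Finset ℕ → (ℕ → Λ.Edge) → Set (Λ.State × (ℕ → Λ.Noise)) :=
        fun S₀ I g => {a | (trajectory p q a t).2 ∈ D ∧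
          (∀ f ∈ S₀, (trajectory p q a t).2 f = false) ∧
          (∀ i ∈ I, a.2 i ∈ smallNoise ε (g i)) ∧
          ∀ f ∈ S, f ∈ weaklyClosed ε s (trajectory p q a t).2 fun k => a.2 (t + k)} with hA
      set X : ℝ := (ε * (1 + s / E)) ^ S.card *
        (ε ^ S₀.card * (ε / E) ^ I.card * μ.real {z | z.2 ∈ D}) with hX
      set times := (Finset.Ioc t (t + s)).filter fun i => i ∉ I with htimes
      have hsub : {a : Λ.State × (ℕ → Λ.Noise) | (trajectory p q a t).2 ∈ D ∧
          (∀ f ∈ S₀, (trajectory p q a t).2 f = false) ∧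
          (∀ i ∈ I, a.2 i ∈ smallNoise ε (g i)) ∧
          ∀ f', f' = f ∨ f' ∈ S →
            f' ∈ weaklyClosed ε s (trajectory p q a t).2 fun k => a.2 (t + k)} ⊆
          A (insert f S₀) I g ∪
            ⋃ i ∈ times, A S₀ (insert i I) (Function.update g i f) := by
        rintro a ⟨h1, h2, h3, h4⟩
        have h5 : ∀ f ∈ S, f ∈ weaklyClosed ε s (trajectory p q a t).2 fun k => a.2 (t + k) :=
          fun f hf => h4 f (Or.inr hf)
        rcases h4 f (Or.inl rfl) with hc | ⟨k, hk1, hk2, hk3, hk4⟩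
        · left
          refine ⟨h1, fun f' hf' => ?_, h3, h5⟩
          rcases Finset.mem_insert.1 hf' with rfl | hf'
          · exact hc
          · exact h2 f' hf'
        · right
          -- A time already used selects an edge outside the remaining set, so it cannot serve f.
          -- The times in I stay distinct and independence applies.
          have hnI : t + k ∉ I := by
            intro hki
            have h6 : (a.2 (t + k)).1 = g (t + k) := (h3 _ hki).1
            exact (hI _ hki).2 (by rw [← h6, hk3]; exact Finset.mem_insert_self f S)
          simp only [Set.mem_iUnion]
          refine ⟨t + k, by simp [htimes, hnI]; omega, h1, h2, fun i hi => ?_, h5⟩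
          rcases Finset.mem_insert.1 hi with rfl | hi
          · rw [Function.update_self]
            exact ⟨hk3, hk4⟩
          · rw [Function.update_of_ne (by rintro rfl; exact hnI hi)]
            exact h3 i hi
      have hb1 : (drivingLaw μ).real (A (insert f S₀) I g) ≤ ε * X := by
        refine (ih' (insert f S₀) I g ?_ ?_ hI').trans_eq ?_
        · intro f' hf'
          rcases Finset.mem_insert.1 hf' with rfl | hf'
          · exact hfR
          · exact hS₀ f' hf'
        · rw [Finset.disjoint_insert_right]
          exact ⟨hf, hdisj.2⟩
        · rw [Finset.card_insert_of_notMem hdisj.1, hX]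
          ring
      have hb2 : ∀ i ∈ times,
          (drivingLaw μ).real (A S₀ (insert i I) (Function.update g i f)) ≤ ε / E * X := by
        intro i hi
        simp only [htimes, Finset.mem_filter, Finset.mem_Ioc] at hi
        refine (ih' S₀ (insert i I) (Function.update g i f) hS₀ hdisj.2 ?_).trans_eq ?_
        · intro j hj
          by_cases hji : j = i
          · subst hji
            exact ⟨hi.1.1, by rwa [Function.update_self]⟩
          · rw [Function.update_of_ne hji]
            exact hI' j ((Finset.mem_insert.1 hj).resolve_left hji)
        · rw [Finset.card_insert_of_notMem hi.2, hX]
          ring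
      have hX0 : 0 ≤ X := by positivity
      have hcard : (times.card : ℝ) ≤ s := by
        have : times.card ≤ s := (Finset.card_filter_le _ _).trans (by simp)
        exact_mod_cast this
      rw [Finset.card_insert_of_notMem hf]
      simp only [Finset.mem_insert]
      refine (measureReal_mono (μ := drivingLaw μ) hsub).trans ?_
      calc (drivingLaw μ).real (A (insert f S₀) I g ∪
            ⋃ i ∈ times, A S₀ (insert i I) (Function.update g i f))
          ≤ (drivingLaw μ).real (A (insert f S₀) I g) +
            ∑ i ∈ times, (drivingLaw μ).real (A S₀ (insert i I) (Function.update g i f)) :=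
          (measureReal_union_le _ _).trans
            (add_le_add le_rfl (measureReal_biUnion_finset_le _ _))
        _ ≤ ε * X + times.card * (ε / E * X) := by
          refine add_le_add hb1 ((Finset.sum_le_sum hb2).trans_eq ?_)
          rw [Finset.sum_const, nsmul_eq_mul]
        _ ≤ ε * X + s * (ε / E * X) := by gcongr
        _ = (ε * (1 + s / E)) ^ (S.card + 1) *
            (ε ^ S₀.card * (ε / E) ^ I.card * μ.real {z | z.2 ∈ D}) := by
          rw [hX]
          ring
  simpa using key S hS ∅ ∅ (fun _ => Classical.arbitrary _) (by simp) (by simp) (by simp)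

end Box

/-! ### Counting and distances -/

lemma dist_latticePoint_le {d : ℕ} {x y : Fin d → ℤ} {r : ℝ} (hr : 0 ≤ r)
    (h : ∀ i, |(x i : ℝ) - y i| ≤ r) : dist (latticePoint x) (latticePoint y) ≤ d * r := by
  have h1 := dist_latticePoint_sq x y
  push_cast at h1
  have h2 : ∑ i, ((x i : ℝ) - y i) ^ 2 ≤ ∑ _i : Fin d, r ^ 2 := by
    refine Finset.sum_le_sum fun i _ => ?_
    rw [← sq_abs]
    exact pow_le_pow_left₀ (abs_nonneg _) (h i) 2
  rw [Finset.sum_const, Finset.card_univ, Fintype.card_fin, nsmul_eq_mul] at h2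
  rcases Nat.eq_zero_or_pos d with rfl | hd
  · simp only [Finset.univ_eq_empty, Finset.sum_empty] at h1
    simp [pow_eq_zero_iff (two_ne_zero) |>.1 h1]
  · have hd1 : (1 : ℝ) ≤ d := by exact_mod_cast hd
    refine le_of_sq_le_sq ?_ (by positivity)
    rw [h1, mul_pow]
    refine h2.trans (mul_le_mul_of_nonneg_right ?_ (sq_nonneg r))
    nlinarith

lemma abs_coord_sub_le_dist {d : ℕ} (x y : EuclideanSpace ℝ (Fin d)) (i : Fin d) :
    |x i - y i| ≤ dist x y := by
  rw [dist_eq_norm]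
  exact PiLp.norm_apply_le (x - y) i

namespace Cube

variable {d : ℕ} {K : Cube d}

/-- The box of radius `L` of `ℤ^d`. -/
noncomputable def offsets (d L : ℕ) : Finset (Fin d → ℤ) :=
  Fintype.piFinset fun _ => Finset.Icc (-(L : ℤ)) L

lemma mem_offsets {d L : ℕ} {x : Fin d → ℤ} : x ∈ offsets d L ↔ ∀ i, |x i| ≤ L := by
  simp [offsets, abs_le]

lemma card_offsets (d L : ℕ) : (offsets d L).card = (2 * L + 1) ^ d := by
  rw [offsets, Fintype.card_piFinset]
  simp only [Int.card_Icc, Finset.prod_const, Finset.card_univ, Fintype.card_fin]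
  congr 1
  omega

-- Both endpoints of g are within ℓ^∞ distance 1+1+1 = 3 of a fixed endpoint of f: across f, across
-- the gap, across g.
open Classical in
lemma card_near_le (f : K.Edge) :
    (Finset.univ.filter fun g : K.Edge => Near f g).card ≤ ((2 * 3 + 1) ^ d) ^ 2 := by
  obtain ⟨x₀, x₁, h₀, hf⟩ := f.exists_eq_mkEdge
  have hx₀ : x₀ ∈ f.1 := by rw [hf]; simp [mkEdge]
  choose u v huv hg using fun g : K.Edge => g.exists_eq_mkEdge
  have hin : ∀ g : K.Edge, Near f g → ∀ y ∈ g.1, y.1 - x₀.1 ∈ offsets d 3 := by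
    rintro g ⟨a, ha, b, hb, hab⟩ y hy
    refine mem_offsets.2 fun i => ?_
    have h1 := abs_le.1 (Edge.abs_sub_le_one f hx₀ ha i)
    have h2 := abs_le.1 (hab i)
    have h3 := abs_le.1 (Edge.abs_sub_le_one g hb hy i)
    simp only [Pi.sub_apply]
    rw [abs_le]
    push_cast
    omega
  rw [← card_offsets, sq, ← Finset.card_product]
  refine Finset.card_le_card_of_injOn (fun g => ((u g).1 - x₀.1, (v g).1 - x₀.1)) ?_ ?_
  · intro g hgN
    have hgN' : Near f g := by simpa using hgN
    have hu : u g ∈ g.1 := by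
      have := congrArg Subtype.val (hg g)
      rw [this]; simp [mkEdge]
    have hv : v g ∈ g.1 := by
      have := congrArg Subtype.val (hg g)
      rw [this]; simp [mkEdge]
    exact Finset.mem_coe.2 (Finset.mem_product.2 ⟨hin g hgN' _ hu, hin g hgN' _ hv⟩)
  · intro g _ g' _ h
    simp only [Prod.mk.injEq, sub_left_inj] at h
    have h1 := Subtype.ext h.1
    have h2 := Subtype.ext h.2
    apply Subtype.ext
    rw [congrArg Subtype.val (hg g), congrArg Subtype.val (hg g')]
    simp only [mkEdge, h1, h2]

open Classical in
/-- The chains of `n` edges which can be appended to a given edge. -/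
noncomputable def chains (K : Cube d) : ℕ → K.Edge → Finset (List K.Edge)
  | 0, _ => {[]}
  | n + 1, e => (Finset.univ.filter fun g : K.Edge => Near e g).biUnion fun g =>
      (chains K n g).image fun l => g :: l

lemma mem_chains {n : ℕ} {e : K.Edge} {l : List K.Edge} (h : (e :: l).IsChain Near)
    (hl : l.length = n) : l ∈ chains K n e := by
  classical
  induction l generalizing n e with
  | nil => subst hl; simp [chains]
  | cons g l ih =>
    subst hl
    rw [List.isChain_cons_cons] at h
    simp only [List.length_cons, chains, Finset.mem_biUnion, Finset.mem_filter, Finset.mem_univ,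
      true_and, Finset.mem_image]
    exact ⟨g, h.1, l, ih h.2 rfl, rfl⟩

lemma card_chains_le (n : ℕ) (e : K.Edge) :
    (chains K n e).card ≤ (((2 * 3 + 1) ^ d) ^ 2) ^ n := by
  classical
  induction n generalizing e with
  | zero => simp [chains]
  | succ n ih =>
    rw [chains, pow_succ']
    refine Finset.card_biUnion_le.trans ?_
    refine (Finset.sum_le_card_nsmul _ _ _ fun g _ => Finset.card_image_le.trans (ih g)).trans ?_
    rw [smul_eq_mul]
    exact Nat.mul_le_mul_right _ (card_near_le e)

lemma norm_le_of_mem_carrier {z : EuclideanSpace ℝ (Fin d)} (hz : z ∈ K.carrier) :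
    ‖z‖ ≤ d * K.halfSide := by
  have h1 : ‖z‖ ^ 2 ≤ d * K.halfSide ^ 2 := by
    rw [← K.basis.sum_sq_norm_inner_right z]
    calc ∑ i, ‖inner ℝ (K.basis i) z‖ ^ 2 ≤ ∑ _i : Fin d, K.halfSide ^ 2 := by
          refine Finset.sum_le_sum fun i _ => ?_
          rw [Real.norm_eq_abs]
          exact pow_le_pow_left₀ (abs_nonneg _) (hz i) 2
      _ = d * K.halfSide ^ 2 := by simp
  have hh := K.halfSide_pos
  have hd1 : (1 : ℝ) ≤ d := by exact_mod_cast Nat.one_le_iff_ne_zero.2 K.axis.pos.ne'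
  refine le_of_sq_le_sq ?_ (by positivity)
  rw [mul_pow]
  refine h1.trans (mul_le_mul_of_nonneg_right ?_ (sq_nonneg _))
  nlinarith

/-- If the box has an edge, every vertex lies at bounded distance from an edge. -/
lemma exists_edge_near [hne : Nonempty K.Edge] (x : K.Vertex) :
    ∃ (g : K.Edge) (y : K.Vertex), y ∈ g.1 ∧ ∀ i, |x.1 i - y.1 i| ≤ ((4 * d ^ 2 + d : ℕ) : ℤ) := by
  have hh := K.halfSide_pos
  have hd1 : (1 : ℝ) ≤ d := by exact_mod_cast Nat.one_le_iff_ne_zero.2 K.axis.pos.ne'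
  have hd0 : (0 : ℝ) < d := by linarith
  have hfin : ∀ y : K.Vertex, dist (latticePoint x.1) (latticePoint y.1) ≤ 4 * d ^ 2 + d →
      ∀ i, |x.1 i - y.1 i| ≤ ((4 * d ^ 2 + d : ℕ) : ℤ) := by
    intro y hy i
    have h1 := (abs_coord_sub_le_dist (latticePoint x.1) (latticePoint y.1) i).trans hy
    have h2 : |((x.1 i : ℤ) : ℝ) - (y.1 i : ℝ)| ≤ 4 * (d : ℝ) ^ 2 + d := h1
    exact_mod_cast h2
  -- In a small cube any edge is close enough. In a large one, x is moved towards the centre to a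
  -- point c around which a ball of radius 2d fits in the cube; the rounding of c and one of its
  -- neighbours then give an edge.
  by_cases hsmall : K.halfSide ≤ 2 * d
  · obtain ⟨g⟩ := hne
    obtain ⟨y, z, h, rfl⟩ := g.exists_eq_mkEdge
    refine ⟨mkEdge y z h, y, by simp [mkEdge], hfin y ?_⟩
    rw [dist_eq_norm]
    have h1 := norm_le_of_mem_carrier x.2
    have h2 := norm_le_of_mem_carrier y.2
    refine (norm_sub_le _ _).trans ?_
    nlinarith
  · push Not at hsmall
    set h := K.halfSide
    set c : EuclideanSpace ℝ (Fin d) := (1 - 2 * d / h) • latticePoint x.1 with hc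
    have hratio : 2 * d / h ≤ 1 := by rw [div_le_one hh]; exact hsmall.le
    have hcin : ∀ i, |inner ℝ (K.basis i) c| ≤ h - 2 * d := by
      intro i
      rw [hc, inner_smul_right, abs_mul, abs_of_nonneg (by linarith)]
      calc (1 - 2 * d / h) * |inner ℝ (K.basis i) (latticePoint x.1)| ≤ (1 - 2 * d / h) * h :=
            mul_le_mul_of_nonneg_left (x.2 i) (by linarith)
        _ = h - 2 * d := by field_simp
    have hclose : ∀ z : EuclideanSpace ℝ (Fin d), ‖z - c‖ ≤ 2 * d → z ∈ K.carrier := by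
      intro z hz i
      have h1 : |inner ℝ (K.basis i) (z - c)| ≤ 2 * d := by
        refine (abs_real_inner_le_norm _ _).trans ?_
        rw [K.basis.norm_eq_one, one_mul]
        exact hz
      have h2 : (inner ℝ (K.basis i) z : ℝ) =
          inner ℝ (K.basis i) (z - c) + inner ℝ (K.basis i) c := by
        rw [← inner_add_right, sub_add_cancel]
      rw [h2]
      refine (abs_add_le _ _).trans ?_
      have := hcin i
      linarith
    have hxc : ‖latticePoint x.1 - c‖ ≤ 2 * d ^ 2 := by
      have h1 : latticePoint x.1 - c = (2 * d / h) • latticePoint x.1 := by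
        rw [hc, sub_smul, one_smul, sub_sub_cancel]
      rw [h1, norm_smul, Real.norm_eq_abs, abs_of_nonneg (by positivity)]
      calc 2 * d / h * ‖latticePoint x.1‖ ≤ 2 * d / h * (d * h) :=
            mul_le_mul_of_nonneg_left (norm_le_of_mem_carrier x.2) (by positivity)
        _ = 2 * d ^ 2 := by field_simp
    set y : Fin d → ℤ := fun i => round (c i) with hy
    have hyc : ‖latticePoint y - c‖ ≤ d := by
      have h1 : ‖latticePoint y - c‖ ^ 2 ≤ d ^ 2 := by
        rw [EuclideanSpace.norm_sq_eq]
        have h2 : ∑ i, ‖(latticePoint y - c) i‖ ^ 2 ≤ ∑ _i : Fin d, (1 : ℝ) := by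
          refine Finset.sum_le_sum fun i _ => ?_
          have h3 : ‖(latticePoint y - c) i‖ ≤ 1 := by
            have h4 : (latticePoint y - c) i = (round (c i) : ℝ) - c i := rfl
            rw [h4, Real.norm_eq_abs, abs_sub_comm]
            exact (abs_sub_round _).trans (by norm_num)
          exact pow_le_one₀ (norm_nonneg _) h3
        simp only [Finset.sum_const, Finset.card_univ, Fintype.card_fin, nsmul_eq_mul,
          mul_one] at h2
        nlinarith
      exact le_of_sq_le_sq h1 hd0.le
    have hadj := lattice_adj_add_single y K.axis
    have hyc' : ‖latticePoint (y + Pi.single K.axis 1) - c‖ ≤ 2 * d := by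
      have h1 : dist (latticePoint y) (latticePoint (y + Pi.single K.axis 1)) = 1 := hadj
      have h2 := dist_triangle (latticePoint (y + Pi.single K.axis 1)) (latticePoint y) c
      rw [dist_comm, dist_comm _ (latticePoint y), h1, dist_eq_norm (latticePoint y), dist_comm,
        dist_eq_norm] at h2
      linarith
    refine ⟨mkEdge ⟨y, hclose _ (by linarith)⟩ ⟨_, hclose _ hyc'⟩ hadj, ⟨y, hclose _ (by linarith)⟩,
      by simp [mkEdge], hfin _ ?_⟩
    refine (dist_triangle _ c _).trans ?_
    rw [dist_eq_norm, dist_comm, dist_eq_norm]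
    nlinarith

/-- If the box has an edge, the number of vertices is at most proportional to the number of
edges. -/
lemma card_vertex_le [Nonempty K.Edge] :
    Nat.card K.Vertex ≤ Fintype.card K.Edge * (2 * (4 * d ^ 2 + d + 1) + 1) ^ d := by
  classical
  choose g y hyg hxy using fun x : K.Vertex => exists_edge_near x
  choose u v huv hg using fun g : K.Edge => g.exists_eq_mkEdge
  have hu : ∀ g : K.Edge, u g ∈ g.1 := by
    intro g
    have := congrArg Subtype.val (hg g)
    rw [this]; simp [mkEdge]
  have hin : ∀ x : K.Vertex, x.1 - (u (g x)).1 ∈ offsets d (4 * d ^ 2 + d + 1) := by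
    intro x
    refine mem_offsets.2 fun i => ?_
    have h1 := abs_le.1 (hxy x i)
    have h2 := abs_le.1 (Edge.abs_sub_le_one (g x) (hyg x) (hu (g x)) i)
    simp only [Pi.sub_apply]
    rw [abs_le]
    push_cast at h1 ⊢
    omega
  -- The extra 1 in the radius allows replacing the endpoint near x by the endpoint `u (g x)`, which
  -- depends only on the edge; x is then recovered from the pair.
  let φ : K.Vertex → K.Edge × offsets d (4 * d ^ 2 + d + 1) := fun x => (g x, ⟨_, hin x⟩)
  have hφ : Function.Injective φ := by
    intro x x' h
    simp only [φ, Prod.mk.injEq, Subtype.mk.injEq] at h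
    have h2 := h.2
    rw [h.1, sub_left_inj] at h2
    exact Subtype.ext h2
  have := Nat.card_le_card_of_injective φ hφ
  rwa [Nat.card_prod, Nat.card_eq_fintype_card (α := K.Edge),
    Nat.card_eq_fintype_card (α := offsets d _), Fintype.card_coe,
    card_offsets] at this

lemma latticePoint_mem_segment {e : K.Edge} {x : K.Vertex} (hx : x ∈ e.1) :
    latticePoint x.1 ∈ K.segment e :=
  subset_convexHull ℝ _ ⟨x, hx, rfl⟩

lemma mem_carrier_of_dist_le {e : K.Edge} {ℓ : ℝ} (h : ENNReal.ofReal ℓ < K.distCompl e)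
    {x : K.Vertex} (hx : x ∈ e.1) {z : EuclideanSpace ℝ (Fin d)}
    (hz : dist (latticePoint x.1) z ≤ ℓ) : z ∈ K.carrier := by
  by_contra hc
  refine absurd h (not_lt.2 ?_)
  refine (iInf₂_le _ (latticePoint_mem_segment hx)).trans ?_
  refine (Metric.infEDist_le_edist_of_mem hc).trans ?_
  rw [edist_dist]
  exact ENNReal.ofReal_le_ofReal hz

lemma notMem_of_dist_lt {e : K.Edge} {ℓ : ℝ} {c : Set K.Edge}
    (h : ENNReal.ofReal ℓ ≤ K.distEdges e c) {x : K.Vertex} (hx : x ∈ e.1) {f : K.Edge}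
    {y : K.Vertex} (hy : y ∈ f.1) (hxy : dist (latticePoint x.1) (latticePoint y.1) < ℓ) :
    f ∉ c := by
  intro hf
  refine absurd h (not_le.2 ?_)
  refine (iInf₂_le _ (latticePoint_mem_segment hx)).trans_lt ?_
  refine (Metric.infEDist_le_edist_of_mem
    (Set.mem_biUnion hf (latticePoint_mem_segment hy))).trans_lt ?_
  rw [edist_dist]
  exact (ENNReal.ofReal_lt_ofReal_iff (dist_nonneg.trans_lt hxy)).2 hxy

end Cube

namespace Box

variable {d : ℕ} {Λ : Box d}

open _root_.FK.Cube

/-! ### Speed of propagation of the pivotal edges -/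

lemma trajectory_isYTrajectory (p q : ℝ) (a : Λ.State × (ℕ → Λ.Noise)) (t : ℕ) :
    IsYTrajectory p q (fun k => (trajectory p q a (t + k)).2) fun k => a.2 (t + k) :=
  fun _ => rfl

/-- The configurations having a closed cut at distance at least `ℓ` from `e`. -/
def farCut (e : Λ.Edge) (ℓ : ℝ) : Set Λ.Config :=
  {ω | ∃ c ∈ cuts ω, ENNReal.ofReal ℓ ≤ Λ.distEdges e c}

lemma not_connects_of_mem_farCut {e : Λ.Edge} {ℓ : ℝ} {ω : Λ.Config} (h : ω ∈ farCut e ℓ) :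
    ¬ Connects ω := by
  obtain ⟨c, hc, -⟩ := h
  exact not_connects_of_separates hc.1.1 hc.2

/-- The far cut cannot contain f, so the same cut stays closed. This stability is what lets finite
energy be applied conditionally on the far cut. -/
lemma openAt_mem_farCut {e : Λ.Edge} {ℓ : ℝ} {ω : Λ.Config} (h : ω ∈ farCut e ℓ) {x : Λ.Vertex}
    (hx : x ∈ e.1) {f : Λ.Edge} {y : Λ.Vertex} (hy : y ∈ f.1)
    (hxy : dist (latticePoint x.1) (latticePoint y.1) < ℓ) : openAt ω f ∈ farCut e ℓ := by
  obtain ⟨c, hc, hd⟩ := h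
  refine ⟨c, ⟨hc.1, fun g hg => ?_⟩, hd⟩
  have hfc := notMem_of_dist_lt hd hx hy hxy
  rw [openAt_of_ne _ (by rintro rfl; exact hfc hg)]
  exact hc.2 g hg

/-- The joint probability that a cut is far from `e` at time `t` and that `e` is pivotal at time
`t + s`. -/
theorem IsEquilibrium.farCut_pivotal_le (hd : 2 ≤ d) {p q : ℝ} (hp0 : 0 < p) (hp1 : p < 1)
    (hq : 1 ≤ q) {ε : ℝ} (hε : ε = (1 - p) * q / p) (hε1 : ε ≤ 1) {μ : Measure Λ.State}
    (hμ : Λ.IsEquilibrium p q μ) (t s : ℕ) {ℓ : ℝ} (hℓ : 1 ≤ ℓ) (e : Λ.Edge)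
    (he : ENNReal.ofReal ℓ < Λ.distCompl e) (N : ℕ) (hN : N ≠ 0 → d * (2 * N + 1 : ℝ) < ℓ) :
    (drivingLaw μ).real {a | (trajectory p q a t).2 ∈ farCut e ℓ ∧
        e ∈ pivotal (trajectory p q a (t + s)).2} ≤
      (((2 * 3 + 1) ^ d) ^ 2 : ℝ) ^ N * ((ε * (1 + s / Fintype.card Λ.Edge)) ^ (N + 1) *
        μ.real {z | z.2 ∈ farCut e ℓ}) := by
  classical
  have : Nonempty Λ.Edge := ⟨e⟩
  have := hμ.isProbabilityMeasure
  have hε0 : 0 ≤ ε := by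
    have : 0 ≤ 1 - p := by linarith
    rw [hε]
    positivity
  obtain ⟨x₀, x₁, h₀, hex⟩ := e.exists_eq_mkEdge
  have hx₀ : x₀ ∈ e.1 := by rw [hex]; simp [mkEdge]
  set R : Set Λ.Edge := {f | ∃ y ∈ f.1, dist (latticePoint x₀.1) (latticePoint y.1) < ℓ} with hR
  have hdist : N ≠ 0 → ∀ z : Fin d → ℤ, (∀ i, |z i - x₀.1 i| ≤ 2 * N + 1) →
      dist (latticePoint x₀.1) (latticePoint z) < ℓ := by
    intro hN0 z hz
    refine lt_of_le_of_lt (dist_latticePoint_le (by positivity) fun i => ?_) (hN hN0)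
    rw [abs_sub_comm]
    exact_mod_cast hz i
  set A : List Λ.Edge → Set (Λ.State × (ℕ → Λ.Noise)) := fun l =>
    {a | (trajectory p q a t).2 ∈ farCut e ℓ ∧ ∀ f ∈ (e :: l).toFinset,
      f ∈ weaklyClosed ε s (trajectory p q a t).2 fun k => a.2 (t + k)} with hA
  set good := (chains Λ.toCube N e).filter fun l =>
    (e :: l).Nodup ∧ l.length = N ∧ ∀ f ∈ e :: l, f ∈ R with hgood
  have hsub : {a : Λ.State × (ℕ → Λ.Noise) | (trajectory p q a t).2 ∈ farCut e ℓ ∧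
      e ∈ pivotal (trajectory p q a (t + s)).2} ⊆ ⋃ l ∈ good, A l := by
    rintro a ⟨ha, hpiv⟩
    obtain ⟨l, hl1, hl2, hl3, hl4⟩ :=
      (trajectory_isYTrajectory p q a t).exists_chain hd (ε := ε)
        (fun ω e => (closeProb_le hp0 hp1 hq ω e).trans_eq hε.symm)
        (not_connects_of_mem_farCut ha) (s := s) hpiv hx₀ N
        (fun hN0 z hz => mem_carrier_of_dist_le he hx₀ (hdist hN0 z hz).le)
    simp only [Set.mem_iUnion]
    refine ⟨l, ?_, ha, fun f hf => (hl4 f (List.mem_toFinset.1 hf)).1⟩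
    rw [hgood, Finset.mem_filter]
    refine ⟨mem_chains hl1 hl3, hl2, hl3, fun f hf => ?_⟩
    -- For N = 0 no room around e is available, and the chain reduces to e itself.
    by_cases hN0 : N = 0
    · rw [hN0, List.length_eq_zero_iff] at hl3
      rw [hl3, List.mem_singleton] at hf
      exact ⟨x₀, by rwa [hf], by rw [dist_self]; linarith⟩
    · obtain ⟨y, z, h, hfe⟩ := f.exists_eq_mkEdge
      have hy : y ∈ f.1 := by rw [hfe]; simp [mkEdge]
      exact ⟨y, hy, hdist hN0 y.1 ((hl4 f hf).2 y hy)⟩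
  have hAl : ∀ l ∈ good, (drivingLaw μ).real (A l) ≤
      (ε * (1 + s / Fintype.card Λ.Edge)) ^ (N + 1) * μ.real {z | z.2 ∈ farCut e ℓ} := by
    intro l hl
    obtain ⟨-, h1, h2, h3⟩ := Finset.mem_filter.1 hl
    have h := hμ.weaklyClosed_le hp0 hp1 hq hε hε1 (farCut e ℓ)
      (fun ω hω => not_connects_of_mem_farCut hω) R
      (fun ω hω f ⟨y, hy, hxy⟩ => openAt_mem_farCut hω hx₀ hy hxy) t s (e :: l).toFinset
      (fun f hf => h3 f (List.mem_toFinset.1 hf))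
    rwa [List.toFinset_card_of_nodup h1, List.length_cons, h2] at h
  refine (measureReal_mono (μ := drivingLaw μ) hsub (measure_ne_top _ _)).trans ?_
  refine (measureReal_biUnion_finset_le _ _).trans ?_
  refine (Finset.sum_le_sum hAl).trans ?_
  rw [Finset.sum_const, nsmul_eq_mul]
  refine mul_le_mul_of_nonneg_right ?_ (by positivity)
  have : good.card ≤ (((2 * 3 + 1) ^ d) ^ 2) ^ N :=
    (Finset.card_filter_le _ _).trans (card_chains_le N e)
  exact_mod_cast this

/-- The bound on the conditional probability, when `p` is close enough to `1`. -/
theorem IsEquilibrium.cond_pivotal_le (hd : 2 ≤ d) {p q : ℝ} (hp0 : 0 < p) (hp1 : p < 1)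
    (hq : 1 ≤ q) {μ : Measure Λ.State} (hμ : Λ.IsEquilibrium p q μ)
    (hε : ((2 * 3 + 1) ^ d) ^ 2 * ((1 - p) * q / p *
      (1 + (2 * (4 * d ^ 2 + d + 1) + 1) ^ d)) ≤ Real.exp (-(4 * d)))
    (t s : ℕ) (hs : s ≤ Λ.card) {ℓ : ℝ} (hℓ : 1 ≤ ℓ) (e : Λ.Edge)
    (he : ENNReal.ofReal ℓ < Λ.distCompl e) :
    (cond (Λ.processLaw p q μ)
        {z | ∃ c ∈ cuts (z t).2, ENNReal.ofReal ℓ ≤ Λ.distEdges e c}).real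
      {z | e ∈ pivotal (z (t + s)).2} ≤ Real.exp (-ℓ) := by
  classical
  have : Nonempty Λ.Edge := ⟨e⟩
  have := hμ.isProbabilityMeasure
  set ε := (1 - p) * q / p with hεdef
  have hε0 : 0 ≤ ε := by
    have : 0 ≤ 1 - p := by linarith
    positivity
  have hd1 : (2 : ℝ) ≤ d := by exact_mod_cast hd
  set C : ℝ := (2 * (4 * d ^ 2 + d + 1) + 1) ^ d with hC
  have hC0 : 0 ≤ C := by positivity
  set D : ℝ := ((2 * 3 + 1) ^ d) ^ 2 with hD
  have hD1 : 1 ≤ D := one_le_pow₀ (one_le_pow₀ (by norm_num))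
  have hε1 : ε ≤ 1 := by
    have h1 : Real.exp (-(4 * d)) ≤ 1 := Real.exp_le_one_iff.2 (by linarith)
    have h2 : ε ≤ ε * (1 + C) := by nlinarith
    have h3 : ε * (1 + C) ≤ D * (ε * (1 + C)) := le_mul_of_one_le_left (by positivity) hD1
    linarith
  set E : ℝ := (Fintype.card Λ.Edge : ℝ) with hE
  have hE0 : 0 < E := Nat.cast_pos.2 Fintype.card_pos
  have hsE : (s : ℝ) / E ≤ C := by
    rw [div_le_iff₀ hE0]
    have h1 := hs.trans (card_vertex_le (K := Λ.toCube))
    have h2 : (s : ℝ) ≤ (Fintype.card Λ.Edge : ℝ) * (2 * (4 * d ^ 2 + d + 1) + 1) ^ d := by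
      exact_mod_cast h1
    rw [mul_comm]
    exact h2
  -- If N ≥ 1 then d(2N+1) ≤ 3dN ≤ 3ℓ/4 < ℓ, so the chains stay in range; and 4d(N+1) > ℓ, so N+1
  -- factors exp(-4d) suffice.
  set N := ⌊ℓ / (4 * d)⌋₊ with hN
  have hN1 : (N : ℝ) ≤ ℓ / (4 * d) := Nat.floor_le (by positivity)
  have hN2 : ℓ / (4 * d) < N + 1 := Nat.lt_floor_add_one _
  rw [le_div_iff₀ (by positivity)] at hN1
  rw [div_lt_iff₀ (by positivity)] at hN2
  have hNℓ : N ≠ 0 → d * (2 * N + 1 : ℝ) < ℓ := by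
    intro h0
    have : (1 : ℝ) ≤ N := by exact_mod_cast Nat.one_le_iff_ne_zero.2 h0
    nlinarith
  have hmain := hμ.farCut_pivotal_le hd hp0 hp1 hq hεdef hε1 t s hℓ e he N hNℓ
  have hbound : D ^ N * (ε * (1 + s / E)) ^ (N + 1) ≤ Real.exp (-ℓ) := by
    calc D ^ N * (ε * (1 + s / E)) ^ (N + 1) ≤ D ^ (N + 1) * (ε * (1 + C)) ^ (N + 1) := by
          gcongr
          exact Nat.le_succ N
      _ = (D * (ε * (1 + C))) ^ (N + 1) := (mul_pow _ _ _).symm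
      _ ≤ Real.exp (-(4 * d)) ^ (N + 1) := pow_le_pow_left₀ (by positivity) hε _
      _ = Real.exp (-((N + 1) * (4 * d))) := by
          rw [← Real.exp_nat_mul]
          congr 1
          push_cast
          ring
      _ ≤ Real.exp (-ℓ) := Real.exp_le_exp.2 (by linarith)
  have hmt := measurable_trajectory (Λ := Λ) p q
  have hmeas : ∀ (k : ℕ) (S : Set Λ.State), MeasurableSet {z : ℕ → Λ.State | z k ∈ S} :=
    fun k S => measurable_pi_apply k (Set.Finite.measurableSet (Set.toFinite S))
  have hB : MeasurableSet {z : ℕ → Λ.State | ∃ c ∈ cuts (z t).2,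
      ENNReal.ofReal ℓ ≤ Λ.distEdges e c} := hmeas t {z | z.2 ∈ farCut e ℓ}
  have hAB : MeasurableSet ({z : ℕ → Λ.State | ∃ c ∈ cuts (z t).2,
      ENNReal.ofReal ℓ ≤ Λ.distEdges e c} ∩ {z | e ∈ pivotal (z (t + s)).2}) :=
    hB.inter (hmeas (t + s) {z | e ∈ pivotal z.2})
  have h1 : (Λ.processLaw p q μ).real ({z : ℕ → Λ.State | ∃ c ∈ cuts (z t).2,
      ENNReal.ofReal ℓ ≤ Λ.distEdges e c} ∩ {z | e ∈ pivotal (z (t + s)).2}) =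
      (drivingLaw μ).real {a | (trajectory p q a t).2 ∈ farCut e ℓ ∧
        e ∈ pivotal (trajectory p q a (t + s)).2} := map_measureReal_apply hmt hAB
  have h2 : (Λ.processLaw p q μ).real {z : ℕ → Λ.State | ∃ c ∈ cuts (z t).2,
      ENNReal.ofReal ℓ ≤ Λ.distEdges e c} = μ.real {z | z.2 ∈ farCut e ℓ} := by
    have h3 := hμ.trajectory_noise t {z | z.2 ∈ farCut e ℓ} ∅ (fun _ => Set.univ) (by simp)
      (fun _ => MeasurableSet.univ)
    simp only [Finset.notMem_empty, false_imp_iff, implies_true, and_true, Finset.prod_empty,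
      mul_one] at h3
    rw [← h3]
    exact map_measureReal_apply hmt hB
  rw [measureReal_def, cond_apply hB, ENNReal.toReal_mul, ENNReal.toReal_inv, ← measureReal_def,
    ← measureReal_def, h1, h2, inv_mul_eq_div]
  -- This form of the division bound also covers a conditioning event of probability 0, where the
  -- quotient is 0.
  refine div_le_of_le_mul₀ measureReal_nonneg (Real.exp_pos _).le (hmain.trans ?_)
  rw [← mul_assoc]
  exact mul_le_mul_of_nonneg_right hbound measureReal_nonneg

end Box

end FK

/-! ### Choice of the threshold -/

theorem mainTheorem5 (d : ℕ) (hd : 2 ≤ d) (q : ℝ) (hq : 1 ≤ q) :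
    ∃ p₀ : ℝ, 0 < p₀ ∧ p₀ < 1 ∧
      ∀ p : ℝ, p₀ ≤ p → p < 1 →
      ∀ (Λ : FK.Box d) (μ : MeasureTheory.Measure Λ.State), Λ.IsEquilibrium p q μ →
      ∀ t s : ℕ, 1 ≤ s → s ≤ Λ.card →
      ∀ ℓ : ℝ, 1 ≤ ℓ →
      ∀ e : Λ.Edge, ENNReal.ofReal ℓ < Λ.distCompl e →
        (ProbabilityTheory.cond (Λ.processLaw p q μ)
            {z | ∃ c ∈ FK.Box.cuts (z t).2, ENNReal.ofReal ℓ ≤ Λ.distEdges e c}).real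
          {z | e ∈ FK.Box.pivotal (z (t + s)).2} ≤ Real.exp (-ℓ) := by
  have hq0 : 0 < q := by linarith
  set M : ℝ := ((2 * 3 + 1) ^ d) ^ 2 * (1 + (2 * (4 * d ^ 2 + d + 1) + 1) ^ d) with hM
  have hM0 : 0 < M := by positivity
  set δ : ℝ := Real.exp (-(4 * d)) / M with hδ
  have hδ0 : 0 < δ := div_pos (Real.exp_pos _) hM0
  -- The condition p ≥ q/(q+δ) is equivalent to (1-p)q/p ≤ δ.
  refine ⟨q / (q + δ), by positivity, (div_lt_one (by positivity)).2 (by linarith), ?_⟩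
  intro p hp hp1 Λ μ hμ t s _ hs ℓ hℓ e he
  have hp0 : 0 < p := lt_of_lt_of_le (by positivity) hp
  refine hμ.cond_pivotal_le hd hp0 hp1 hq ?_ t s hs hℓ e he
  rw [div_le_iff₀ (by positivity)] at hp
  have h1 : (1 - p) * q / p ≤ δ := by
    rw [div_le_iff₀ hp0]
    linarith
  calc ((2 * 3 + 1) ^ d) ^ 2 * ((1 - p) * q / p * (1 + (2 * (4 * (d : ℝ) ^ 2 + d + 1) + 1) ^ d))
      = (1 - p) * q / p * M := by rw [hM]; ring
    _ ≤ δ * M := mul_le_mul_of_nonneg_right h1 hM0.le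
    _ = Real.exp (-(4 * d)) := div_mul_cancel₀ _ hM0.ne'
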